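/- Let $k$ be a field, $n\ge 2$, and let $X=\mathbb P^n_k$. For a quasi-coherent $\mathcal O_X$-module $\mathcal F$ and $N\ge 0$ let $\mathcal J^N(\mathcal F/k)$ be the $N$-th jet sheaf, which on an affine open $\operatorname{Spec}B\subseteq X$ with $\mathcal F|_{\operatorname{Spec}B}=\widetilde M$ is given by the $B$-module $(B\otimes_kM)/I^{N+1}(B\otimes_kM)$, where $I=\ker(B\otimes_kB\to B)$ is the kernel of the multiplication and $B$ acts through the left factor; let $d^N:\mathcal F\to\mathcal J^N(\mathcal F/k)$, $m\mapsto 1\otimes m$. A differential operator $\mathcal F_1\to\mathcal F_2$ of order $\le N$ is a ($k$-linear) map of sheaves of the form $\widetilde D\circ d^N$ with $\widetilde D:\mathcal J^N(\mathcal F_1/k)\to\mathcal F_2$ an $\mathcal O_X$-linear map; $H^0(X,DO^N(\mathcal F_1,\mathcal F_2))$ denotes the set of these. An operator has order $N$ if it is of order $\le N$ but not of order $\le M$ for any $M<N$. (1) For all nonzero locally free sheaves $\mathcal F_1,\mathcal F_2$ of finite rank on $X$ there is an integer $N_0=N_0(\mathcal F_1,\mathcal F_2)\ge 1$ such that for every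 $N\ge N_0$ $$H^0(X,DO^{N-1}(\mathcal F_1,\mathcal F_2))\subsetneq H^0(X,DO^{N}(\mathcal F_1,\mathcal F_2)),$$ and there is a global differential operator $\mathcal F_1\to\mathcal F_2$ of order $N$. (2) In particular, for every nonzero locally free sheaf $\mathcal E$ of finite rank on $X$ and every $d\in\mathbb Z$ there is an integer $N_0\ge 1$ such that for every $N\ge N_0$ there is a global differential operator $\mathcal E\to\mathcal E(d)$ of order $N$. -/

import Mathlib

open AlgebraicGeometry CategoryTheory TensorProduct Opposite

universe u v w

noncomputable section

namespace GlobalDiffOp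

section Algebra

variable (A : Type u) (B : Type v) (M : Type w) [CommRing A] [CommRing B] [Algebra A B]
  [AddCommGroup M] [Module A M] [Module B M] [IsScalarTower A B M]

/-- The action of `B ⊗[A] B` on `B ⊗[A] M`: `(b ⊗ b') · (c ⊗ m) = bc ⊗ b'm`. -/
def biAct : B ⊗[A] B →ₐ[A] Module.End A (B ⊗[A] M) :=
  (Module.endTensorEndAlgHom (R := A) (S := A) (A := A) (M := B) (N := M)).comp
    (Algebra.TensorProduct.map (Algebra.lsmul A A B) (Algebra.lsmul A A M))

@[simp]
lemma biAct_tmul (b b' c : B) (m : M) :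
    biAct A B M (b ⊗ₜ b') (c ⊗ₜ m) = (b * c) ⊗ₜ (b' • m) := rfl

/-- The submodule `I ^ (N + 1) · (B ⊗[A] M)`, where `I` is the kernel of the multiplication
`B ⊗[A] B → B`. -/
def jetRel (N : ℕ) : Submodule B (B ⊗[A] M) :=
  Submodule.span B
    {y | ∃ t ∈ (KaehlerDifferential.ideal A B) ^ (N + 1), ∃ x, biAct A B M t x = y}

/-- The `N`-th jet module of a `B`-module `M` relative to `A`,
with the `B`-module structure coming from the left tensor factor. -/
def Jet (N : ℕ) : Type (max v w) := (B ⊗[A] M) ⧸ jetRel A B M N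

instance (N : ℕ) : AddCommGroup (Jet A B M N) :=
  inferInstanceAs (AddCommGroup ((B ⊗[A] M) ⧸ jetRel A B M N))

instance (N : ℕ) : Module B (Jet A B M N) :=
  inferInstanceAs (Module B ((B ⊗[A] M) ⧸ jetRel A B M N))

/-- The quotient map `B ⊗[A] M → Jet A B M N`. -/
def Jet.mk (N : ℕ) : B ⊗[A] M →ₗ[B] Jet A B M N := (jetRel A B M N).mkQ

/-- The universal differential operator `m ↦ 1 ⊗ m`. -/
def Jet.d (N : ℕ) : M →+ Jet A B M N :=
  (Jet.mk A B M N).toAddMonoidHom.comp (TensorProduct.mk A B M 1).toAddMonoidHom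

variable {A B M}
variable {B' : Type v} {M' : Type w} [CommRing B'] [Algebra A B']
  [AddCommGroup M'] [Module A M'] [Module B' M'] [IsScalarTower A B' M']

lemma map_biAct (φ : B →ₐ[A] B') (g : M →ₗ[A] M')
    (hg : ∀ (b : B) (m : M), g (b • m) = φ b • g m) (t : B ⊗[A] B) (x : B ⊗[A] M) :
    TensorProduct.map φ.toLinearMap g (biAct A B M t x) =
      biAct A B' M' (Algebra.TensorProduct.map φ φ t) (TensorProduct.map φ.toLinearMap g x) := by
  induction t with
  | zero => simp
  | add a b ha hb => simp [ha, hb]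
  | tmul b b' =>
    induction x with
    | zero => simp
    | add a b ha hb => simp [ha, hb]
    | tmul c m => simp [hg]

lemma map_mem_ideal (φ : B →ₐ[A] B') {t : B ⊗[A] B} {N : ℕ}
    (ht : t ∈ (KaehlerDifferential.ideal A B) ^ N) :
    Algebra.TensorProduct.map φ φ t ∈ (KaehlerDifferential.ideal A B') ^ N := by
  have h : (KaehlerDifferential.ideal A B).map (Algebra.TensorProduct.map φ φ) ≤
      KaehlerDifferential.ideal A B' := by
    rw [Ideal.map_le_iff_le_comap]
    intro s hs
    have key : ∀ s : B ⊗[A] B,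
        Algebra.TensorProduct.lmul' A (Algebra.TensorProduct.map φ φ s) =
          φ (Algebra.TensorProduct.lmul' A s) := by
      intro s
      induction s with
      | zero => simp
      | add a b ha hb => simp [ha, hb]
      | tmul b b' => simp
    have hs' : Algebra.TensorProduct.lmul' A (S := B) s = 0 := hs
    change Algebra.TensorProduct.lmul' A (S := B') (Algebra.TensorProduct.map φ φ s) = 0
    rw [key, hs', map_zero]
  have := Ideal.mem_map_of_mem (Algebra.TensorProduct.map φ φ) ht
  rw [Ideal.map_pow] at this
  exact Ideal.pow_right_mono h N this

/-- Functoriality of jet modules, for a semilinear map `g` over a ring homomorphism `φ`. -/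
def Jet.map (N : ℕ) (φ : B →ₐ[A] B') (g : M →ₗ[A] M')
    (hg : ∀ (b : B) (m : M), g (b • m) = φ b • g m) : Jet A B M N →+ Jet A B' M' N :=
  QuotientAddGroup.lift (jetRel A B M N).toAddSubgroup
    ((Jet.mk A B' M' N).toAddMonoidHom.comp
      (TensorProduct.map φ.toLinearMap g).toAddMonoidHom) (by
    intro x hx
    have hsm : ∀ (b : B) (x : B ⊗[A] M), TensorProduct.map φ.toLinearMap g (b • x) =
        φ b • TensorProduct.map φ.toLinearMap g x := by
      intro b x
      induction x with
      | zero => simp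
      | add a b ha hb => simp [ha, hb]
      | tmul c m => simp [TensorProduct.smul_tmul']
    change Jet.mk A B' M' N (TensorProduct.map φ.toLinearMap g x) = 0
    refine (Submodule.Quotient.mk_eq_zero _).2 ?_
    induction hx using Submodule.span_induction with
    | mem x h =>
      obtain ⟨t, ht, x, rfl⟩ := h
      rw [map_biAct φ g hg]
      exact Submodule.subset_span ⟨_, map_mem_ideal φ ht, _, rfl⟩
    | zero => simp
    | add x y _ _ hx hy => simpa using add_mem hx hy
    | smul b x _ hx => rw [hsm]; exact Submodule.smul_mem _ _ hx)

lemma Jet.map_mk (N : ℕ) (φ : B →ₐ[A] B') (g : M →ₗ[A] M')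
    (hg : ∀ (b : B) (m : M), g (b • m) = φ b • g m) (x : B ⊗[A] M) :
    Jet.map N φ g hg (Jet.mk A B M N x) =
      Jet.mk A B' M' N (TensorProduct.map φ.toLinearMap g x) := rfl

lemma Jet.map_smul (N : ℕ) (φ : B →ₐ[A] B') (g : M →ₗ[A] M')
    (hg : ∀ (b : B) (m : M), g (b • m) = φ b • g m) (b : B) (x : Jet A B M N) :
    Jet.map N φ g hg (b • x) = φ b • Jet.map N φ g hg x := by
  obtain ⟨x, rfl⟩ := Submodule.mkQ_surjective _ x
  change Jet.map N φ g hg (b • Jet.mk A B M N x) = φ b • Jet.map N φ g hg (Jet.mk A B M N x)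
  rw [← _root_.map_smul, Jet.map_mk, Jet.map_mk, ← _root_.map_smul]
  congr 1
  induction x with
  | zero => simp
  | add a b ha hb => simp [ha, hb]
  | tmul c m => simp [TensorProduct.smul_tmul']

lemma Jet.map_d (N : ℕ) (φ : B →ₐ[A] B') (g : M →ₗ[A] M')
    (hg : ∀ (b : B) (m : M), g (b • m) = φ b • g m) (m : M) :
    Jet.map N φ g hg (Jet.d A B M N m) = Jet.d A B' M' N (g m) := by
  change Jet.mk A B' M' N (TensorProduct.map φ.toLinearMap g (1 ⊗ₜ m)) = _
  simp [Jet.d]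

end Algebra

section Geometry

variable {k : Type u} [CommRing k] {X : Scheme.{u}} [X.Over (Spec (CommRingCat.of k))]

variable (k) in
/-- The `k`-algebra structure on `Γ(X, U)` for a scheme `X` over `Spec k`. -/
abbrev sectionsAlgebra (U : X.Opens) : Algebra k Γ(X, U) :=
  ((X.presheaf.map (homOfLE (le_top : U ≤ ⊤)).op).hom.comp
    ((X ↘ Spec (CommRingCat.of k)).appTop.hom.comp
      (Scheme.ΓSpecIso (CommRingCat.of k)).inv.hom)).toAlgebra

attribute [local instance] sectionsAlgebra

variable (k) in
/-- The `k`-module structure on the sections of an `𝒪_X`-module, for `X` over `Spec k`. -/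
abbrev sectionsModule (F : X.Modules) (U : X.Opens) : Module k Γ(F, U) :=
  Module.compHom Γ(F, U) (algebraMap k Γ(X, U))

attribute [local instance] sectionsModule

lemma sectionsScalarTower (F : X.Modules) (U : X.Opens) :
    IsScalarTower k Γ(X, U) Γ(F, U) :=
  ⟨fun a b m => by rw [Algebra.smul_def, mul_smul]; rfl⟩

attribute [local instance] sectionsScalarTower

variable (k) in
/-- Restriction of functions, as a `k`-algebra homomorphism. -/
def resAlg {U V : X.Opens} (i : V ⟶ U) : Γ(X, U) →ₐ[k] Γ(X, V) where
  __ := (X.presheaf.map i.op).hom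
  commutes' a := by
    change (X.presheaf.map i.op).hom ((X.presheaf.map (homOfLE (le_top : U ≤ ⊤)).op).hom _) =
      (X.presheaf.map (homOfLE (le_top : V ≤ ⊤)).op).hom _
    rw [← CommRingCat.comp_apply, ← Functor.map_comp]
    rfl

variable (k) in
/-- Restriction of sections of an `𝒪_X`-module, as a `k`-linear map. -/
def resLin (F : X.Modules) {U V : X.Opens} (i : V ⟶ U) : Γ(F, U) →ₗ[k] Γ(F, V) where
  __ := (F.presheaf.map i.op).hom
  map_smul' a m := by
    change (F.presheaf.map i.op).hom (algebraMap k Γ(X, U) a • m) =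
      algebraMap k Γ(X, V) a • (F.presheaf.map i.op).hom m
    rw [← (resAlg k i).commutes a]
    exact F.map_smul i _ m

lemma resLin_smul (F : X.Modules) {U V : X.Opens} (i : V ⟶ U) (b : Γ(X, U)) (m : Γ(F, U)) :
    resLin k F i (b • m) = resAlg k i b • resLin k F i m :=
  F.map_smul i b m

variable (k) in
/-- The abelian presheaf `U ↦ J^N(Γ(F, U) / k)`. -/
def jetAb (F : X.Modules) (N : ℕ) : X.Opensᵒᵖ ⥤ AddCommGrpCat.{u} where
  obj U := AddCommGrpCat.of (Jet k Γ(X, U.unop) Γ(F, U.unop) N)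
  map i := AddCommGrpCat.ofHom
    (Jet.map N (resAlg k i.unop) (resLin k F i.unop) (resLin_smul F i.unop))
  map_id U := by
    ext x
    obtain ⟨x, rfl⟩ := Submodule.mkQ_surjective _ x
    change Jet.mk k _ _ N _ = Jet.mk k _ _ N x
    congr 1
    induction x with
    | zero => simp
    | add a b ha hb => rw [map_add, ha, hb]
    | tmul c m =>
      have h1 : resAlg k (𝟙 U.unop) c = c := by
        change (X.presheaf.map (𝟙 U)).hom c = c
        simp
      have h2 : resLin k F (𝟙 U.unop) m = m := by
        change (F.presheaf.map (𝟙 U)).hom m = m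
        simp
      change resAlg k (𝟙 U.unop) c ⊗ₜ resLin k F (𝟙 U.unop) m = _
      rw [h1, h2]
  map_comp {U V W} i j := by
    ext x
    obtain ⟨x, rfl⟩ := Submodule.mkQ_surjective _ x
    change Jet.mk k _ _ N _ = Jet.mk k _ _ N _
    congr 1
    induction x with
    | zero => simp
    | add a b ha hb => simp only [map_add, ha, hb]
    | tmul c m =>
      have h1 : resAlg k (i ≫ j).unop c = resAlg k j.unop (resAlg k i.unop c) := by
        change (X.presheaf.map (i ≫ j)).hom c =
          (X.presheaf.map j).hom ((X.presheaf.map i).hom c)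
        simp
      have h2 : resLin k F (i ≫ j).unop m = resLin k F j.unop (resLin k F i.unop m) := by
        change (F.presheaf.map (i ≫ j)).hom m =
          (F.presheaf.map j).hom ((F.presheaf.map i).hom m)
        simp
      change resAlg k (i ≫ j).unop c ⊗ₜ resLin k F (i ≫ j).unop m = _
      rw [h1, h2]
      rfl

instance (F : X.Modules) (N : ℕ) (U : X.Opensᵒᵖ) :
    Module (X.ringCatSheaf.obj.obj U) ((jetAb k F N).obj U) :=
  inferInstanceAs (Module Γ(X, U.unop) (Jet k Γ(X, U.unop) Γ(F, U.unop) N))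

variable (k) in
/-- The presheaf of `𝒪_X`-modules `U ↦ J^N(Γ(F, U) / k)`. -/
def jetPresheaf (F : X.Modules) (N : ℕ) : X.PresheafOfModules :=
  PresheafOfModules.ofPresheaf (R := X.ringCatSheaf.obj) (jetAb k F N) (by
    intro U V i r m
    exact Jet.map_smul N (resAlg k i.unop) (resLin k F i.unop) (resLin_smul F i.unop) r m)

variable (k) in
/-- The jet sheaf `J^N(F / k)`: the sheaf of `𝒪_X`-modules associated to
`U ↦ J^N(Γ(F, U) / k)`. -/
def jetSheaf (F : X.Modules) (N : ℕ) : X.Modules :=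
  (PresheafOfModules.sheafification (𝟙 X.ringCatSheaf.obj)).obj (jetPresheaf k F N)

variable (k) in
/-- The universal differential operator `F → J^N(F / k)` into the jet presheaf. -/
def jetPreD (F : X.Modules) (N : ℕ) : F.presheaf ⟶ (jetPresheaf k F N).presheaf where
  app U := AddCommGrpCat.ofHom (Jet.d k Γ(X, U.unop) Γ(F, U.unop) N)
  naturality U V i := by
    ext m
    exact (Jet.map_d N (resAlg k i.unop) (resLin k F i.unop) (resLin_smul F i.unop) m).symm

variable (k) in
/-- The universal differential operator `F → J^N(F / k)`. -/
def jetD (F : X.Modules) (N : ℕ) : F.presheaf ⟶ (jetSheaf k F N).presheaf :=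
  jetPreD k F N ≫ CategoryTheory.toSheafify _ (jetPresheaf k F N).presheaf

lemma jetD_smul (F : X.Modules) (N : ℕ) (U : X.Opens) (a : k) (m : Γ(F, U)) :
    (jetD k F N).app (op U) (a • m) = a • (jetD k F N).app (op U) m := by
  have h1 : (jetPreD k F N).app (op U) (a • m) =
      (algebraMap k Γ(X, U) a • (Jet.d k Γ(X, U) Γ(F, U) N m) : Jet k Γ(X, U) Γ(F, U) N) := by
    change Jet.mk k Γ(X, U) Γ(F, U) N (1 ⊗ₜ (a • m)) =
      algebraMap k Γ(X, U) a • Jet.mk k Γ(X, U) Γ(F, U) N (1 ⊗ₜ m)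
    rw [← _root_.map_smul, TensorProduct.tmul_smul, TensorProduct.smul_tmul',
      TensorProduct.smul_tmul', Algebra.smul_def, smul_eq_mul]
  let η := (PresheafOfModules.sheafificationAdjunction (𝟙 X.ringCatSheaf.obj)).unit.app
    (jetPresheaf k F N)
  have h2 : (jetD k F N).app (op U) (a • m) = algebraMap k Γ(X, U) a •
      (show Γ(jetSheaf k F N, U) from (jetD k F N).app (op U) m) := by
    change η.app (op U) ((jetPreD k F N).app (op U) (a • m)) = _
    rw [h1]
    exact (η.app (op U)).hom.map_smul (algebraMap k Γ(X, U) a)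
      ((jetPreD k F N).app (op U) m)
  exact h2

variable (k) in
/-- The set `H⁰(X, DO^N(F₁, F₂))` of global differential operators `F₁ → F₂` of order `≤ N`
relative to `k`: the morphisms of abelian sheaves `F₁ → F₂` that are the composite of the universal
operator `F₁ → J^N(F₁ / k)` with an `𝒪_X`-linear morphism `J^N(F₁ / k) → F₂`.  They are
automatically `k`-linear, see `diffOps_smul`. -/
def diffOps (F₁ F₂ : X.Modules) (N : ℕ) : Set (F₁.presheaf ⟶ F₂.presheaf) :=
  Set.range fun D : jetSheaf k F₁ N ⟶ F₂ => jetD k F₁ N ≫ D.mapPresheaf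

lemma diffOps_smul {F₁ F₂ : X.Modules} {N : ℕ} {D : F₁.presheaf ⟶ F₂.presheaf}
    (hD : D ∈ diffOps k F₁ F₂ N) (U : X.Opens) (a : k) (m : Γ(F₁, U)) :
    D.app (op U) (a • m) = a • D.app (op U) m := by
  obtain ⟨E, rfl⟩ := hD
  change E.app U ((jetD k F₁ N).app (op U) (a • m)) =
    algebraMap k Γ(X, U) a • E.app U ((jetD k F₁ N).app (op U) m)
  rw [jetD_smul]
  exact Scheme.Modules.Hom.app_smul E _ _

variable (k) in
/-- A differential operator has order `N` if it is of order `≤ N`, but not of order `≤ M` for any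
`M < N`. -/
def HasOrder {F₁ F₂ : X.Modules} (D : F₁.presheaf ⟶ F₂.presheaf) (N : ℕ) : Prop :=
  D ∈ diffOps k F₁ F₂ N ∧ ∀ M < N, D ∉ diffOps k F₁ F₂ M

/-- Locally free sheaves of finite rank: locally, `F` is freely generated by finitely many
sections. -/
def IsLocallyFreeOfFiniteRank (F : X.Modules) : Prop :=
  ∃ q : SheafOfModules.LocalGeneratorsData.{u} (R := X.ringCatSheaf) F,
    q.IsLocallyFreeData ∧ q.IsFiniteType

end Geometry

section Twist

variable {X : Scheme.{u}}

/-- Restriction of functions. -/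
def resFun {U V : X.Opens} (h : V ≤ U) : Γ(X, U) →+* Γ(X, V) := (X.presheaf.map (homOfLE h).op).hom

/-- Restriction of sections of an `𝒪_X`-module. -/
def resSec (E : X.Modules) {U V : X.Opens} (h : V ≤ U) : Γ(E, U) →+ Γ(E, V) :=
  (E.presheaf.map (homOfLE h).op).hom

lemma resFun_resFun {U V W : X.Opens} (h : V ≤ U) (h' : W ≤ V) (b : Γ(X, U)) :
    resFun h' (resFun h b) = resFun (h'.trans h) b := by
  simp only [resFun]
  rw [← CommRingCat.comp_apply, ← Functor.map_comp]
  rfl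

lemma resSec_resSec (E : X.Modules) {U V W : X.Opens} (h : V ≤ U) (h' : W ≤ V) (s : Γ(E, U)) :
    resSec E h' (resSec E h s) = resSec E (h'.trans h) s := by
  simp only [resSec]
  rw [← AddCommGrpCat.comp_apply, ← Functor.map_comp]
  rfl

lemma resSec_self (E : X.Modules) {U : X.Opens} (s : Γ(E, U)) :
    resSec E (le_refl U) s = s := by
  change (E.presheaf.map (𝟙 (op U))).hom s = s
  simp

lemma resSec_smul (E : X.Modules) {U V : X.Opens} (h : V ≤ U) (b : Γ(X, U)) (s : Γ(E, U)) :
    resSec E h (b • s) = resFun h b • resSec E h s :=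
  E.map_smul _ b s

variable {ι : Type} (D : ι → X.Opens) (g : ∀ i j, Γ(X, D i ⊓ D j)) (E : X.Modules)

/-- Families of sections `s i` of `E` over `U ⊓ D i` such that `s j = g i j • s i` over
`U ⊓ (D i ⊓ D j)`. -/
def gluedSections (U : X.Opens) : AddSubgroup (∀ i, Γ(E, U ⊓ D i)) where
  carrier := {s | ∀ i j,
    resSec E (inf_le_inf_left U inf_le_right : U ⊓ (D i ⊓ D j) ≤ U ⊓ D j) (s j) =
      resFun (inf_le_right : U ⊓ (D i ⊓ D j) ≤ D i ⊓ D j) (g i j) •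
        resSec E (inf_le_inf_left U inf_le_left : U ⊓ (D i ⊓ D j) ≤ U ⊓ D i) (s i)}
  zero_mem' := by intro i j; simp
  add_mem' := by
    intro s t hs ht i j
    simp only [Pi.add_apply, map_add, smul_add, hs i j, ht i j]
  neg_mem' := by
    intro s hs i j
    simp only [Pi.neg_apply, map_neg, smul_neg, hs i j]

lemma gluedSections_smul {U : X.Opens} (b : Γ(X, U)) {s : ∀ i, Γ(E, U ⊓ D i)}
    (hs : s ∈ gluedSections D g E U) :
    (fun i => resFun (inf_le_left : U ⊓ D i ≤ U) b • s i) ∈ gluedSections D g E U := by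
  intro i j
  simp only [resSec_smul, resFun_resFun, hs i j, smul_smul, mul_comm]

instance (U : X.Opens) : Module Γ(X, U) (gluedSections D g E U) where
  smul b s := ⟨fun i => resFun (inf_le_left : U ⊓ D i ≤ U) b • s.1 i,
    gluedSections_smul D g E b s.2⟩
  one_smul s := Subtype.ext <| funext fun i => by
    change resFun _ 1 • s.1 i = s.1 i
    simp
  mul_smul a b s := Subtype.ext <| funext fun i => by
    change resFun _ (a * b) • s.1 i = resFun _ a • resFun _ b • s.1 i
    rw [map_mul, mul_smul]
  smul_zero a := Subtype.ext <| funext fun i => by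
    change resFun _ a • (0 : Γ(E, U ⊓ D i)) = 0
    simp
  smul_add a s t := Subtype.ext <| funext fun i => by
    change resFun (inf_le_left : U ⊓ D i ≤ U) a • (s.1 i + t.1 i) =
      resFun (inf_le_left : U ⊓ D i ≤ U) a • s.1 i + resFun (inf_le_left : U ⊓ D i ≤ U) a • t.1 i
    rw [smul_add]
  add_smul a b s := Subtype.ext <| funext fun i => by
    change resFun (inf_le_left : U ⊓ D i ≤ U) (a + b) • s.1 i =
      resFun (inf_le_left : U ⊓ D i ≤ U) a • s.1 i + resFun (inf_le_left : U ⊓ D i ≤ U) b • s.1 i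
    rw [map_add, add_smul]
  zero_smul s := Subtype.ext <| funext fun i => by
    change resFun (inf_le_left : U ⊓ D i ≤ U) 0 • s.1 i = 0
    rw [map_zero, zero_smul]

/-- Restriction of glued sections. -/
def gluedRes {U V : X.Opens} (h : V ≤ U) : gluedSections D g E U →+ gluedSections D g E V where
  toFun s := ⟨fun i => resSec E (inf_le_inf_right (D i) h) (s.1 i), fun i j => by
    have := congrArg (resSec E (inf_le_inf_right (D i ⊓ D j) h)) (s.2 i j)
    simpa only [resSec_smul, resFun_resFun, resSec_resSec] using this⟩
  map_zero' := Subtype.ext <| funext fun i => map_zero _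
  map_add' s t := Subtype.ext <| funext fun i => map_add _ _ _

/-- The abelian presheaf of glued sections. -/
def gluedAb : X.Opensᵒᵖ ⥤ AddCommGrpCat.{u} where
  obj U := AddCommGrpCat.of (gluedSections D g E U.unop)
  map i := AddCommGrpCat.ofHom (gluedRes D g E (leOfHom i.unop))
  map_id U := by
    ext s i
    exact resSec_self E (s.1 i)
  map_comp a b := by
    ext s i
    exact (resSec_resSec E (inf_le_inf_right (D i) (leOfHom a.unop))
      (inf_le_inf_right (D i) (leOfHom b.unop)) (s.1 i)).symm

instance (U : X.Opensᵒᵖ) : Module (X.ringCatSheaf.obj.obj U) ((gluedAb D g E).obj U) :=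
  inferInstanceAs (Module Γ(X, U.unop) (gluedSections D g E U.unop))

lemma gluedRes_smul_aux {U V : X.Opens} (h : V ≤ U) {i : ι} (r : Γ(X, U))
    (m : Γ(E, U ⊓ D i)) :
    resSec E (inf_le_inf_right (D i) h) (resFun (inf_le_left : U ⊓ D i ≤ U) r • m) =
      resFun (inf_le_left : V ⊓ D i ≤ V) (resFun h r) •
        resSec E (inf_le_inf_right (D i) h) m := by
  rw [resSec_smul, resFun_resFun, resFun_resFun]

/-- The presheaf of `𝒪_X`-modules of glued sections. -/
def gluedPresheaf : X.PresheafOfModules :=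
  PresheafOfModules.ofPresheaf (R := X.ringCatSheaf.obj) (gluedAb D g E) (by
    intro U V f r m
    refine Subtype.ext <| funext fun i => ?_
    exact gluedRes_smul_aux D E (leOfHom f.unop) r (m.1 i))

lemma resSec_ext {κ : Type u} (W : κ → X.Opens) {V : X.Opens} (hW : ∀ a, W a ≤ V)
    (hV : V ≤ iSup W) {s t : Γ(E, V)} (h : ∀ a, resSec E (hW a) s = resSec E (hW a) t) : s = t :=
  TopCat.Sheaf.eq_of_locally_eq' ⟨E.presheaf, E.isSheaf⟩ W V (fun a => homOfLE (hW a)) hV s t h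

lemma resSec_glue {κ : Type u} (W : κ → X.Opens) {V : X.Opens} (hW : ∀ a, W a ≤ V)
    (hV : V ≤ iSup W) (s : ∀ a, Γ(E, W a))
    (h : ∀ a b, resSec E (inf_le_left : W a ⊓ W b ≤ W a) (s a) =
      resSec E (inf_le_right : W a ⊓ W b ≤ W b) (s b)) :
    ∃ t : Γ(E, V), ∀ a, resSec E (hW a) t = s a :=
  (TopCat.Sheaf.existsUnique_gluing' ⟨E.presheaf, E.isSheaf⟩ W V (fun a => homOfLE (hW a)) hV s
    h).exists

lemma gluedAb_isSheaf : TopCat.Presheaf.IsSheaf (gluedAb D g E) := by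
  rw [TopCat.Presheaf.isSheaf_iff_isSheafUniqueGluing]
  intro κ W sf hsf
  have hcov : ∀ i, iSup W ⊓ D i ≤ ⨆ a, W a ⊓ D i := fun i => by rw [iSup_inf_eq]
  have hle : ∀ i a, W a ⊓ D i ≤ iSup W ⊓ D i := fun i a => inf_le_inf_right _ (le_iSup W a)
  have hglue : ∀ i, ∃ t : Γ(E, iSup W ⊓ D i), ∀ a, resSec E (hle i a) t = (sf a).1 i := by
    intro i
    refine resSec_glue E (fun a => W a ⊓ D i) (hle i) (hcov i) (fun a => (sf a).1 i) ?_
    intro a b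
    have h1 := congrFun (congrArg Subtype.val (hsf a b)) i
    change resSec E (inf_le_inf_right (D i) inf_le_left : (W a ⊓ W b) ⊓ D i ≤ W a ⊓ D i)
        ((sf a).1 i) =
      resSec E (inf_le_inf_right (D i) inf_le_right : (W a ⊓ W b) ⊓ D i ≤ W b ⊓ D i)
        ((sf b).1 i) at h1
    have h2 := congrArg (resSec E (le_inf (inf_le_inf inf_le_left inf_le_left)
      (inf_le_left.trans inf_le_right) : (W a ⊓ D i) ⊓ (W b ⊓ D i) ≤ (W a ⊓ W b) ⊓ D i)) h1
    simpa only [resSec_resSec] using h2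
  choose t ht using hglue
  refine ⟨⟨t, ?_⟩, ?_, ?_⟩
  · intro i j
    refine resSec_ext E (fun a => W a ⊓ (D i ⊓ D j))
      (fun a => inf_le_inf_right _ (le_iSup W a)) (by rw [iSup_inf_eq]) ?_
    intro a
    have h1 := (sf a).2 i j
    rw [← ht i a, ← ht j a] at h1
    simpa only [resSec_smul, resFun_resFun, resSec_resSec] using h1
  · intro a
    exact Subtype.ext <| funext fun i => ht i a
  · intro s hs
    refine Subtype.ext <| funext fun i => ?_
    refine resSec_ext E (fun a => W a ⊓ D i) (hle i) (hcov i) fun a => ?_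
    rw [ht i a]
    exact congrFun (congrArg Subtype.val (hs a)) i

/-- The sheaf of `𝒪_X`-modules obtained from the restrictions of `E` to the open sets `D i` by
gluing along the transition functions `g i j`. -/
def glued : X.Modules where
  val := gluedPresheaf D g E
  isSheaf := gluedAb_isSheaf D g E

end Twist

section ProjectiveSpace

attribute [local instance] MvPolynomial.gradedAlgebra

variable (k : Type u) [Field k] (n : ℕ)

/-- Projective `n`-space over `k`: the scheme `Proj k[x₀, …, xₙ]`. -/
def ProjectiveSpace : Scheme.{u} := Proj (MvPolynomial.homogeneousSubmodule (Fin (n + 1)) k)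

instance : (ProjectiveSpace k n).Over (Spec (CommRingCat.of k)) where
  hom := Proj.toSpecZero (MvPolynomial.homogeneousSubmodule (Fin (n + 1)) k) ≫
    Spec.map (CommRingCat.ofHom
      (algebraMap k (MvPolynomial.homogeneousSubmodule (Fin (n + 1)) k 0)))

variable {k n}

/-- The open set `D₊(xᵢ)`. -/
def chart (i : Fin (n + 1)) : (ProjectiveSpace k n).Opens :=
  Proj.basicOpen (MvPolynomial.homogeneousSubmodule (Fin (n + 1)) k) (MvPolynomial.X i)

/-- The function `xᵢ / xⱼ` on `D₊(xⱼ)`. -/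
def coord (i j : Fin (n + 1)) : Γ(ProjectiveSpace k n, chart j) :=
  (Proj.awayToSection (MvPolynomial.homogeneousSubmodule (Fin (n + 1)) k)
    (MvPolynomial.X j)).hom
    (HomogeneousLocalization.Away.mk _ (MvPolynomial.isHomogeneous_X k j) 1 (MvPolynomial.X i)
      (MvPolynomial.isHomogeneous_X k i))

/-- The function `(xᵢ / xⱼ) ^ d` on `D₊(xᵢ) ∩ D₊(xⱼ)`, for an integer `d`.  At most one of the two
exponents on the right-hand side is non-zero. -/
def coordPow (d : ℤ) (i j : Fin (n + 1)) : Γ(ProjectiveSpace k n, chart i ⊓ chart j) :=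
  resFun inf_le_right (coord i j) ^ d.toNat * resFun inf_le_left (coord j i) ^ (-d).toNat

/-- The Serre twist `E(d) = E ⊗ 𝒪(d)` of a sheaf of modules on projective space.  Since `xᵢ ^ d`
is a basis of `𝒪(d)` over `D₊(xᵢ)`, a section of `E ⊗ 𝒪(d)` over `U` is a family of sections
`sᵢ` of `E` over `U ∩ D₊(xᵢ)` with `sᵢ ⊗ xᵢ ^ d = sⱼ ⊗ xⱼ ^ d`, that is,
`sⱼ = (xᵢ / xⱼ) ^ d • sᵢ`, over `U ∩ D₊(xᵢ) ∩ D₊(xⱼ)`. -/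
def serreTwist (E : (ProjectiveSpace k n).Modules) (d : ℤ) : (ProjectiveSpace k n).Modules :=
  glued chart (coordPow d) E

end ProjectiveSpace

end GlobalDiffOp

end

noncomputable section

namespace GlobalDiffOp

/-! ### Hasse derivatives on the field of fractions. -/

section Field

variable {k : Type u} [Field k] {n : ℕ}

/-! Let `K = k(x₀, …, xₙ)`. Sections of a locally free sheaf embed in `K ^ r` by their coordinates
at the generic point, in a basis over a fixed nonempty open set (`IsBasisOn.genCoords_injective`). A
morphism of abelian sheaves `F₁ → F₂` can therefore be given as an additive map `K ^ r₁ → K ^ r₂`,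
as soon as this map carries sections to sections (`exists_hom_of_genCoords`). The map used here
sends one chosen coordinate to one chosen coordinate by `γ ∂_N γ`. Here `∂_N` is the Hasse
derivative in `y = x_q / x_p`, that is, the coefficient of `τ ^ N` in the substitution `x_q ↦ x_q +
τ x_p`, and `γ = (f / x_p ^ d) ^ c`, where both bases are defined on `D₊(f)`.

Two kinds of poles have to be cancelled. Along `f = 0`, the given bases differ from bases near a
point by matrices with poles; the factor `f ^ c` on each side clears them for large `c`
(`eventually_mem_regularAt`), and compactness makes `c` uniform (`exists_uniform_section`). Along
`x_p = 0`, the two factors `γ` create a pole of order at most `2dc`, which does not depend on `N`.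
Seen from the chart `i`, however, `∂_N` is `(x_p / x_i) ^ N` times an operator that preserves
regularity and does not worsen poles along `x_p = 0` (`coeff_shift_pole`). Hence every `N ≥ 2dc`
works (`conjOp_mul_mem`).

The order is exactly `N`. The substitution is a ring homomorphism, so `b ⊗ b' ↦ b · shift(b')` sends
the diagonal ideal `I` into `(τ)` (`X_pow_dvd_shiftTensor`). The coefficient of `τ ^ N` thus kills
`I ^ (N + 1)`, while `(1 ⊗ y - y ⊗ 1) ^ N` goes to `τ ^ N` and produces the value `γ ^ 2 ≠ 0` on a
basis section (`exists_hasOrder`). With Hasse derivatives the argument is independent of the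
characteristic. -/

variable (k n) in
/-- The field of fractions of the polynomial ring `k[x₀, …, xₙ]`. -/
abbrev FracField : Type u := FractionRing (MvPolynomial (Fin (n + 1)) k)

/-- The inclusion of the polynomial ring in its field of fractions. -/
def toFrac : MvPolynomial (Fin (n + 1)) k →+* FracField k n :=
  algebraMap _ _

lemma toFrac_injective : Function.Injective (toFrac (k := k) (n := n)) :=
  IsFractionRing.injective _ _

lemma toFrac_ne_zero {a : MvPolynomial (Fin (n + 1)) k} (ha : a ≠ 0) : toFrac a ≠ 0 := by
  rwa [Ne, map_eq_zero_iff _ toFrac_injective]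

lemma not_mem_ne_zero {P : Ideal (MvPolynomial (Fin (n + 1)) k)}
    {b : MvPolynomial (Fin (n + 1)) k} (hb : b ∉ P) : b ≠ 0 := by
  rintro rfl
  exact hb P.zero_mem

/-- The fractions `a / b` with `a` and `b` homogeneous of the same degree and `b ∉ P`. -/
def regularAt (P : Ideal (MvPolynomial (Fin (n + 1)) k)) [hP : P.IsPrime] :
    Subring (FracField k n) where
  carrier := {u | ∃ (m : ℕ) (a b : MvPolynomial (Fin (n + 1)) k), a.IsHomogeneous m ∧
    b.IsHomogeneous m ∧ b ∉ P ∧ u = toFrac a / toFrac b}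
  one_mem' := ⟨0, 1, 1, MvPolynomial.isHomogeneous_one _ _, MvPolynomial.isHomogeneous_one _ _,
    (Ideal.ne_top_iff_one P).1 hP.ne_top, by simp⟩
  zero_mem' := ⟨0, 0, 1, MvPolynomial.isHomogeneous_zero _ _ _, MvPolynomial.isHomogeneous_one _ _,
    (Ideal.ne_top_iff_one P).1 hP.ne_top, by simp⟩
  mul_mem' := by
    rintro _ _ ⟨m, a, b, ha, hb, hbP, rfl⟩ ⟨m', a', b', ha', hb', hbP', rfl⟩
    exact ⟨m + m', a * a', b * b', ha.mul ha', hb.mul hb', fun h => (hP.mem_or_mem h).elim hbP hbP',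
      by rw [map_mul, map_mul, div_mul_div_comm]⟩
  add_mem' := by
    rintro _ _ ⟨m, a, b, ha, hb, hbP, rfl⟩ ⟨m', a', b', ha', hb', hbP', rfl⟩
    refine ⟨m + m', a * b' + b * a', b * b', (ha.mul hb').add (hb.mul ha'), hb.mul hb',
      fun h => (hP.mem_or_mem h).elim hbP hbP', ?_⟩
    rw [div_add_div _ _ (toFrac_ne_zero (not_mem_ne_zero hbP))
      (toFrac_ne_zero (not_mem_ne_zero hbP'))]
    simp only [map_add, map_mul]
  neg_mem' := by
    rintro _ ⟨m, a, b, ha, hb, hbP, rfl⟩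
    exact ⟨m, -a, b, ha.neg, hb, hbP, by rw [map_neg, neg_div]⟩

lemma div_mem_regularAt {P : Ideal (MvPolynomial (Fin (n + 1)) k)} [P.IsPrime] {m : ℕ}
    {a b : MvPolynomial (Fin (n + 1)) k} (ha : a.IsHomogeneous m) (hb : b.IsHomogeneous m)
    (hbP : b ∉ P) : toFrac a / toFrac b ∈ regularAt P :=
  ⟨m, a, b, ha, hb, hbP, rfl⟩

/-- The homomorphism `x_q ↦ x_q + τ x_i`, fixing the other variables. -/
def shiftPoly (q i : Fin (n + 1)) :
    MvPolynomial (Fin (n + 1)) k →+* PowerSeries (MvPolynomial (Fin (n + 1)) k) :=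
  MvPolynomial.eval₂Hom (PowerSeries.C.comp MvPolynomial.C) fun j =>
    PowerSeries.C (MvPolynomial.X j) +
      if j = q then PowerSeries.X * PowerSeries.C (MvPolynomial.X i) else 0

lemma constantCoeff_shiftPoly (q i : Fin (n + 1)) (a : MvPolynomial (Fin (n + 1)) k) :
    PowerSeries.constantCoeff (shiftPoly q i a) = a := by
  suffices h : PowerSeries.constantCoeff.comp (shiftPoly q i) =
      RingHom.id (MvPolynomial (Fin (n + 1)) k) from RingHom.congr_fun h a
  refine MvPolynomial.ringHom_ext (fun c => ?_) (fun j => ?_)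
  · simp [shiftPoly]
  · by_cases h : j = q <;> simp [shiftPoly, h]

/-- Power series with homogeneous coefficients of degree `m`. -/
def HomogeneousCoeffs (m : ℕ) (f : PowerSeries (MvPolynomial (Fin (n + 1)) k)) : Prop :=
  ∀ j, (PowerSeries.coeff j f).IsHomogeneous m

lemma HomogeneousCoeffs.mul {m m' : ℕ} {f g : PowerSeries (MvPolynomial (Fin (n + 1)) k)}
    (hf : HomogeneousCoeffs m f) (hg : HomogeneousCoeffs m' g) :
    HomogeneousCoeffs (m + m') (f * g) := fun j => by
  rw [PowerSeries.coeff_mul]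
  exact MvPolynomial.IsHomogeneous.sum _ _ _ fun x _ => (hf _).mul (hg _)

lemma HomogeneousCoeffs.C {m : ℕ} {a : MvPolynomial (Fin (n + 1)) k} (ha : a.IsHomogeneous m) :
    HomogeneousCoeffs m (PowerSeries.C a) := fun j => by
  rw [PowerSeries.coeff_C]
  split_ifs
  exacts [ha, MvPolynomial.isHomogeneous_zero _ _ _]

lemma homogeneousCoeffs_X : HomogeneousCoeffs 0
    (PowerSeries.X : PowerSeries (MvPolynomial (Fin (n + 1)) k)) := fun j => by
  rw [PowerSeries.coeff_X]
  split_ifs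
  exacts [MvPolynomial.isHomogeneous_one _ _, MvPolynomial.isHomogeneous_zero _ _ _]

lemma HomogeneousCoeffs.add {m : ℕ} {f g : PowerSeries (MvPolynomial (Fin (n + 1)) k)}
    (hf : HomogeneousCoeffs m f) (hg : HomogeneousCoeffs m g) :
    HomogeneousCoeffs m (f + g) := fun j => by
  rw [map_add]
  exact (hf j).add (hg j)

/-- Each variable goes to a linear form when `τ` is given degree 0, so the degree is kept. This is
why degree-zero fractions have degree-zero Hasse derivatives. -/
lemma homogeneousCoeffs_shiftPoly_monomial (q i : Fin (n + 1)) (s : Fin (n + 1) →₀ ℕ) (c : k) :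
    HomogeneousCoeffs s.degree (shiftPoly q i (MvPolynomial.monomial s c)) := by
  have hone : HomogeneousCoeffs 0 (1 : PowerSeries (MvPolynomial (Fin (n + 1)) k)) := by
    simpa using HomogeneousCoeffs.C (n := n) (MvPolynomial.isHomogeneous_C (Fin (n + 1)) (1 : k))
  have hX : ∀ j, HomogeneousCoeffs 1 (shiftPoly (k := k) q i (MvPolynomial.X j)) := by
    intro j
    rw [shiftPoly, MvPolynomial.coe_eval₂Hom, MvPolynomial.eval₂_X]
    refine (HomogeneousCoeffs.C (MvPolynomial.isHomogeneous_X k j)).add ?_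
    split_ifs
    · simpa using homogeneousCoeffs_X.mul (HomogeneousCoeffs.C (MvPolynomial.isHomogeneous_X k i))
    · intro l
      simpa using MvPolynomial.isHomogeneous_zero _ _ _
  induction s using Finsupp.induction_linear generalizing c with
  | zero =>
    have h : shiftPoly q i (MvPolynomial.C c) = PowerSeries.C (MvPolynomial.C c) := by
      simp [shiftPoly]
    rw [← MvPolynomial.C_apply, h]
    simpa using HomogeneousCoeffs.C (MvPolynomial.isHomogeneous_C (Fin (n + 1)) c)
  | add s t hs ht =>
    have h : MvPolynomial.monomial (s + t) c =
        MvPolynomial.monomial s c * MvPolynomial.monomial t (1 : k) := by simp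
    rw [h, map_mul, map_add]
    exact (hs c).mul (ht 1)
  | single j m =>
    have h : MvPolynomial.monomial (Finsupp.single j m) c =
        MvPolynomial.C c * MvPolynomial.X j ^ m := by
      rw [MvPolynomial.X_pow_eq_monomial, MvPolynomial.C_mul_monomial, mul_one]
    have hC : shiftPoly q i (MvPolynomial.C c) = PowerSeries.C (MvPolynomial.C c) := by
      simp [shiftPoly]
    rw [h, map_mul, map_pow, hC, Finsupp.degree_single]
    have hp : ∀ m : ℕ, HomogeneousCoeffs m (shiftPoly (k := k) q i (MvPolynomial.X j) ^ m) := by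
      intro m
      induction m with
      | zero => simpa using hone
      | succ m ih => rw [pow_succ]; exact ih.mul (hX j)
    simpa using (HomogeneousCoeffs.C (MvPolynomial.isHomogeneous_C (Fin (n + 1)) c)).mul (hp m)

lemma homogeneousCoeffs_shiftPoly (q i : Fin (n + 1)) {m : ℕ} {a : MvPolynomial (Fin (n + 1)) k}
    (ha : a.IsHomogeneous m) : HomogeneousCoeffs m (shiftPoly q i a) := by
  rw [MvPolynomial.as_sum a, map_sum]
  intro j
  rw [map_sum]
  refine MvPolynomial.IsHomogeneous.sum _ _ _ fun s hs => ?_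
  have := ha (MvPolynomial.mem_support_iff.1 hs)
  have hd : s.degree = m := (DFunLike.congr_fun Finsupp.degree_eq_weight_one s).trans this
  rw [← hd]
  exact homogeneousCoeffs_shiftPoly_monomial q i s _ j

lemma isUnit_map_shiftPoly (q i : Fin (n + 1))
    (a : nonZeroDivisors (MvPolynomial (Fin (n + 1)) k)) :
    IsUnit (((PowerSeries.map toFrac).comp (shiftPoly q i)) (a : MvPolynomial (Fin (n + 1)) k)) := by
  rw [PowerSeries.isUnit_iff_constantCoeff, RingHom.comp_apply,
    ← PowerSeries.coeff_zero_eq_constantCoeff_apply, PowerSeries.coeff_map,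
    PowerSeries.coeff_zero_eq_constantCoeff_apply, constantCoeff_shiftPoly, isUnit_iff_ne_zero]
  exact toFrac_ne_zero (nonZeroDivisors.ne_zero a.2)

/-- The extension to the field of fractions of the homomorphism `x_q ↦ x_q + τ x_i`.  Its
coefficients form a Hasse–Schmidt derivation. -/
def shift (q i : Fin (n + 1)) : FracField k n →+* PowerSeries (FracField k n) :=
  IsLocalization.lift (isUnit_map_shiftPoly q i)

lemma shift_toFrac (q i : Fin (n + 1)) (a : MvPolynomial (Fin (n + 1)) k) :
    shift q i (toFrac a) = PowerSeries.map toFrac (shiftPoly q i a) :=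
  IsLocalization.lift_eq _ _

lemma constantCoeff_shift (q i : Fin (n + 1)) (u : FracField k n) :
    PowerSeries.constantCoeff (shift q i u) = u := by
  suffices h : PowerSeries.constantCoeff.comp (shift q i) = RingHom.id (FracField k n) from
    RingHom.congr_fun h u
  refine IsLocalization.ringHom_ext (nonZeroDivisors (MvPolynomial (Fin (n + 1)) k)) ?_
  refine RingHom.ext fun a => ?_
  change PowerSeries.constantCoeff (shift q i (toFrac _)) = toFrac _
  rw [shift_toFrac, ← PowerSeries.coeff_zero_eq_constantCoeff_apply, PowerSeries.coeff_map,
    PowerSeries.coeff_zero_eq_constantCoeff_apply, constantCoeff_shiftPoly]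

lemma shift_C (q i : Fin (n + 1)) (c : k) :
    shift q i (toFrac (MvPolynomial.C c)) = PowerSeries.C (toFrac (MvPolynomial.C c)) := by
  rw [shift_toFrac]
  simp [shiftPoly]

lemma shift_X (q i j : Fin (n + 1)) :
    shift (k := k) q i (toFrac (MvPolynomial.X j)) = PowerSeries.C (toFrac (MvPolynomial.X j)) +
      if j = q then PowerSeries.X * PowerSeries.C (toFrac (MvPolynomial.X i)) else 0 := by
  rw [shift_toFrac]
  by_cases h : j = q <;> simp [shiftPoly, h]

lemma rescale_C {R : Type*} [CommRing R] (c r : R) :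
    PowerSeries.rescale c (PowerSeries.C r) = PowerSeries.C r := by
  ext j
  rw [PowerSeries.coeff_rescale, PowerSeries.coeff_C]
  split_ifs with h <;> simp [h]

/-- As `τ x_p = ((x_p / x_i) τ) x_i`, the two homomorphisms agree on the variables. This change of
chart supplies the zero of order `N` along `x_p = 0` that pays for all poles there. -/
lemma shift_eq_rescale (q p i : Fin (n + 1)) (u : FracField k n) :
    shift q p u = PowerSeries.rescale
      (toFrac (MvPolynomial.X p) / toFrac (MvPolynomial.X i)) (shift q i u) := by
  suffices h : shift q p = (PowerSeries.rescale
      (toFrac (MvPolynomial.X p) / toFrac (MvPolynomial.X i))).comp (shift (k := k) q i) from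
    RingHom.congr_fun h u
  have hi : toFrac (k := k) (MvPolynomial.X i) ≠ 0 := toFrac_ne_zero (MvPolynomial.X_ne_zero i)
  refine IsLocalization.ringHom_ext (nonZeroDivisors (MvPolynomial (Fin (n + 1)) k)) ?_
  refine MvPolynomial.ringHom_ext (fun c => ?_) (fun j => ?_)
  · change shift q p (toFrac _) = PowerSeries.rescale _ (shift q i (toFrac _))
    rw [shift_C, shift_C, rescale_C]
  · change shift q p (toFrac _) = PowerSeries.rescale _ (shift q i (toFrac _))
    rw [shift_X, shift_X]
    by_cases h : j = q
    · simp only [h, if_true, map_add, map_mul, rescale_C, PowerSeries.rescale_X]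
      rw [mul_right_comm, ← map_mul, div_mul_cancel₀ _ hi, mul_comm]
    · simp [h, rescale_C]

lemma coeff_shift_eq (q p i : Fin (n + 1)) (N : ℕ) (u : FracField k n) :
    PowerSeries.coeff N (shift q p u) =
      (toFrac (MvPolynomial.X p) / toFrac (MvPolynomial.X i)) ^ N *
        PowerSeries.coeff N (shift q i u) := by
  rw [shift_eq_rescale q p i, PowerSeries.coeff_rescale]

/-- After division by `b`, the shifts of `a` and `b` have coefficients regular at `P`, and that of
`b` has constant term 1, so it is invertible over `regularAt P`. Nothing is required of `x_i`, which
may lie in `P`. -/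
lemma coeff_shift_mem (q i : Fin (n + 1)) {P : Ideal (MvPolynomial (Fin (n + 1)) k)} [P.IsPrime]
    {u : FracField k n} (hu : u ∈ regularAt P) :
    ∃ f : PowerSeries (regularAt P), PowerSeries.map (regularAt P).subtype f = shift q i u := by
  obtain ⟨m, a, b, ha, hb, hbP, rfl⟩ := hu
  have hb0 := toFrac_ne_zero (not_mem_ne_zero hbP)
  have key : ∀ a : MvPolynomial (Fin (n + 1)) k, a.IsHomogeneous m →
      ∃ f : PowerSeries (regularAt P), PowerSeries.map (regularAt P).subtype f =
        shift q i (toFrac a) * PowerSeries.C (toFrac b)⁻¹ := by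
    intro a ha
    refine ⟨PowerSeries.mk fun j => ⟨_, div_mem_regularAt
      (homogeneousCoeffs_shiftPoly q i ha j) hb hbP⟩, ?_⟩
    ext j
    rw [PowerSeries.coeff_map, PowerSeries.coeff_mk, shift_toFrac, PowerSeries.coeff_mul_C,
      PowerSeries.coeff_map]
    rfl
  obtain ⟨α, hα⟩ := key a ha
  obtain ⟨β, hβ⟩ := key b hb
  have hβ1 : PowerSeries.constantCoeff β = 1 := by
    apply Subtype.ext
    have := congrArg PowerSeries.constantCoeff hβ
    rw [map_mul, constantCoeff_shift, PowerSeries.constantCoeff_C, mul_inv_cancel₀ hb0] at this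
    rw [← PowerSeries.coeff_zero_eq_constantCoeff_apply, PowerSeries.coeff_map] at this
    rwa [← PowerSeries.coeff_zero_eq_constantCoeff_apply]
  have hunit : IsUnit β := by
    rw [PowerSeries.isUnit_iff_constantCoeff, hβ1]
    exact isUnit_one
  obtain ⟨β', rfl⟩ := hunit
  refine ⟨α * ↑β'⁻¹, ?_⟩
  have h1 : shift q i (toFrac a / toFrac b) * PowerSeries.map (regularAt P).subtype β' =
      PowerSeries.map (regularAt P).subtype α := by
    rw [hα, hβ, ← mul_assoc, ← map_mul, div_mul_cancel₀ _ hb0]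
  rw [map_mul, ← h1, mul_assoc, ← map_mul, Units.mul_inv, map_one, mul_one]

/-- The coefficients of `shift q p` lower the order of the poles along `x_p = 0`. -/
lemma coeff_shift_pole {q p : Fin (n + 1)} (hpq : p ≠ q) {i : Fin (n + 1)}
    {P : Ideal (MvPolynomial (Fin (n + 1)) k)} [P.IsPrime]
    {u : FracField k n} (hu : u ∈ regularAt P) (b N : ℕ) :
    ∃ v ∈ regularAt P, PowerSeries.coeff N
      (shift q p ((toFrac (MvPolynomial.X i) / toFrac (MvPolynomial.X p)) ^ b * u)) =
        (toFrac (MvPolynomial.X p) / toFrac (MvPolynomial.X i)) ^ N *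
          ((toFrac (MvPolynomial.X i) / toFrac (MvPolynomial.X p)) ^ b * v) := by
  have hp : toFrac (k := k) (MvPolynomial.X p) ≠ 0 := toFrac_ne_zero (MvPolynomial.X_ne_zero p)
  -- Since `p ≠ q`, the shift fixes `x_p`; it multiplies `x_i` by 1, or by `1 + τ` if `i = q`. The
  -- pole `x_i / x_p` only acquires a regular factor.
  have hε : ∃ ε : PowerSeries (regularAt P), shift (k := k) q i (toFrac (MvPolynomial.X i) /
      toFrac (MvPolynomial.X p)) = PowerSeries.C (toFrac (MvPolynomial.X i) /
      toFrac (MvPolynomial.X p)) * PowerSeries.map (regularAt P).subtype ε := by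
    have h1 : shift (k := k) q i (toFrac (MvPolynomial.X i) / toFrac (MvPolynomial.X p)) *
        PowerSeries.C (toFrac (MvPolynomial.X p)) = shift q i (toFrac (MvPolynomial.X i)) := by
      have := shift_X (k := k) q i p
      rw [if_neg hpq, add_zero] at this
      rw [← this, ← map_mul, div_mul_cancel₀ _ hp]
    refine ⟨1 + if i = q then PowerSeries.X else 0, ?_⟩
    have h2 : PowerSeries.C (toFrac (k := k) (n := n) (MvPolynomial.X p)) *
        PowerSeries.C (toFrac (MvPolynomial.X p))⁻¹ = 1 := by
      rw [← map_mul, mul_inv_cancel₀ hp, map_one]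
    rw [← mul_one (shift q i _), ← h2, ← mul_assoc, h1, shift_X, div_eq_mul_inv, map_mul]
    split_ifs
    · simp only [map_add, map_one, PowerSeries.map_X]
      ring
    · simp
  obtain ⟨ε, hε⟩ := hε
  obtain ⟨f, hf⟩ := coeff_shift_mem q i hu
  refine ⟨((PowerSeries.coeff N (ε ^ b * f) : regularAt P) : FracField k n),
    Subtype.coe_prop _, ?_⟩
  rw [coeff_shift_eq q p i, map_mul, map_pow, hε, ← hf, mul_pow, ← map_pow, ← map_pow, mul_assoc,
    ← map_mul, PowerSeries.coeff_C_mul, PowerSeries.coeff_map]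
  rfl

/-- In the affine coordinate `y = x_q / x_p` the shift is the translation `y ↦ y + τ`; the lower
bound on the order rests on this. -/
lemma shift_div {q p : Fin (n + 1)} (hpq : p ≠ q) :
    shift (k := k) q p (toFrac (MvPolynomial.X q) / toFrac (MvPolynomial.X p)) =
      PowerSeries.C (toFrac (MvPolynomial.X q) / toFrac (MvPolynomial.X p)) + PowerSeries.X := by
  have hp : toFrac (k := k) (MvPolynomial.X p) ≠ 0 := toFrac_ne_zero (MvPolynomial.X_ne_zero p)
  have hC : PowerSeries.C (toFrac (k := k) (MvPolynomial.X p)) ≠ 0 := by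
    rwa [Ne, map_eq_zero_iff _ PowerSeries.C_injective]
  refine mul_right_cancel₀ hC ?_
  have h1 := shift_X (k := k) q p p
  rw [if_neg hpq, add_zero] at h1
  rw [add_mul, ← map_mul, div_mul_cancel₀ _ hp]
  conv_lhs => rw [← h1]
  rw [← map_mul, div_mul_cancel₀ _ hp, shift_X, if_pos rfl]

end Field

/-! ### Functions on projective space as elements of the field of fractions. -/

section Evaluation

attribute [local instance] MvPolynomial.gradedAlgebra

variable {k : Type u} [Field k] {n : ℕ}

/-- The homogeneous prime ideal of a point of projective space. -/
def pointIdeal (x : ProjectiveSpace k n) : Ideal (MvPolynomial (Fin (n + 1)) k) :=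
  (ProjectiveSpectrum.asHomogeneousIdeal
    (𝒜 := MvPolynomial.homogeneousSubmodule (Fin (n + 1)) k) x).toIdeal

instance (x : ProjectiveSpace k n) : (pointIdeal x).IsPrime :=
  ProjectiveSpectrum.isPrime (𝒜 := MvPolynomial.homogeneousSubmodule (Fin (n + 1)) k) x

variable (k n) in
/-- The generic point of projective space. -/
def genPoint : ProjectiveSpace k n :=
  show ProjectiveSpectrum (MvPolynomial.homogeneousSubmodule (Fin (n + 1)) k) from
  { asHomogeneousIdeal := ⊥
    isPrime := by
      rw [HomogeneousIdeal.toIdeal_bot]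
      exact Ideal.isPrime_bot
    not_irrelevant_le := fun h => by
      have h1 : (MvPolynomial.X 0 : MvPolynomial (Fin (n + 1)) k) ∈
          HomogeneousIdeal.irrelevant (MvPolynomial.homogeneousSubmodule (Fin (n + 1)) k) := by
        rw [HomogeneousIdeal.mem_irrelevant_iff, GradedRing.proj_apply]
        exact DirectSum.decompose_of_mem_ne _
          ((MvPolynomial.mem_homogeneousSubmodule _ _).2 (MvPolynomial.isHomogeneous_X k 0))
          one_ne_zero
      have h2 := h h1
      rw [← HomogeneousIdeal.mem_iff, HomogeneousIdeal.toIdeal_bot, Ideal.mem_bot] at h2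
      exact MvPolynomial.X_ne_zero 0 h2 }

lemma pointIdeal_genPoint : pointIdeal (genPoint k n) = ⊥ := HomogeneousIdeal.toIdeal_bot

/-- The open set where a polynomial does not vanish. -/
def basicOpen (f : MvPolynomial (Fin (n + 1)) k) : (ProjectiveSpace k n).Opens :=
  Proj.basicOpen (MvPolynomial.homogeneousSubmodule (Fin (n + 1)) k) f

lemma mem_basicOpen {f : MvPolynomial (Fin (n + 1)) k} {x : ProjectiveSpace k n} :
    x ∈ basicOpen f ↔ f ∉ pointIdeal x := Iff.rfl

lemma basicOpen_mul (f g : MvPolynomial (Fin (n + 1)) k) :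
    basicOpen (f * g) = basicOpen f ⊓ basicOpen g := Proj.basicOpen_mul _ f g

lemma genPoint_mem_basicOpen {f : MvPolynomial (Fin (n + 1)) k} :
    genPoint k n ∈ basicOpen f ↔ f ≠ 0 := by
  rw [mem_basicOpen, pointIdeal_genPoint, Ideal.mem_bot]

lemma genPoint_mem_chart (i : Fin (n + 1)) : genPoint k n ∈ chart (k := k) i :=
  genPoint_mem_basicOpen.2 (MvPolynomial.X_ne_zero i)

/-- Basic open sets of homogeneous polynomials form a basis. -/
lemma exists_basicOpen_le {U : (ProjectiveSpace k n).Opens} {x : ProjectiveSpace k n}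
    (hx : x ∈ U) : ∃ (m : ℕ) (f : MvPolynomial (Fin (n + 1)) k), f.IsHomogeneous m ∧
      x ∈ basicOpen f ∧ basicOpen f ≤ U := by
  obtain ⟨_, ⟨f, rfl⟩, hxf, hfU⟩ := TopologicalSpace.Opens.isBasis_iff_nbhd.1
    (Proj.isBasis_basicOpen (MvPolynomial.homogeneousSubmodule (Fin (n + 1)) k)) hx
  rw [Proj.basicOpen_eq_iSup_proj] at hxf hfU
  obtain ⟨m, hm⟩ := TopologicalSpace.Opens.mem_iSup.1 hxf
  exact ⟨m, _, (MvPolynomial.mem_homogeneousSubmodule _ _).1 (SetLike.coe_mem _), hm,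
    (le_iSup (fun i => Proj.basicOpen (MvPolynomial.homogeneousSubmodule (Fin (n + 1)) k)
      (GradedRing.proj (MvPolynomial.homogeneousSubmodule (Fin (n + 1)) k) i f)) m).trans hfU⟩

lemma genPoint_mem {U : (ProjectiveSpace k n).Opens} {x : ProjectiveSpace k n} (hx : x ∈ U) :
    genPoint k n ∈ U := by
  obtain ⟨m, f, -, hxf, hfU⟩ := exists_basicOpen_le hx
  exact hfU (genPoint_mem_basicOpen.2 (not_mem_ne_zero (mem_basicOpen.1 hxf)))

lemma exists_mem_chart (x : ProjectiveSpace k n) : ∃ i, x ∈ chart (k := k) i := by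
  have h := Proj.iSup_basicOpen_eq_top' (MvPolynomial.homogeneousSubmodule (Fin (n + 1)) k)
    (fun i : Fin (n + 1) => MvPolynomial.X i)
    (fun i => ⟨1, (MvPolynomial.mem_homogeneousSubmodule _ _).2 (MvPolynomial.isHomogeneous_X k i)⟩)
    (by
      rw [eq_top_iff]
      rintro a -
      induction a using MvPolynomial.induction_on with
      | C c =>
        exact Subalgebra.algebraMap_mem _ (⟨MvPolynomial.C c,
          (MvPolynomial.mem_homogeneousSubmodule _ _).2 (MvPolynomial.isHomogeneous_C _ c)⟩ :
          MvPolynomial.homogeneousSubmodule (Fin (n + 1)) k 0)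
      | add p q hp hq => exact add_mem hp hq
      | mul_X p i hp => exact mul_mem hp (Algebra.subset_adjoin ⟨i, rfl⟩))
  have hx : x ∈ (⊤ : (ProjectiveSpace k n).Opens) := trivial
  exact TopologicalSpace.Opens.mem_iSup.1 (h.symm ▸ hx)

/-- The homogeneous local ring of a point, as a subring of the field of fractions. -/
def localValue (x : ProjectiveSpace k n) :
    HomogeneousLocalization.AtPrime (MvPolynomial.homogeneousSubmodule (Fin (n + 1)) k)
      (pointIdeal x) →+* FracField k n :=
  (IsLocalization.lift (M := (pointIdeal x).primeCompl) (S := Localization.AtPrime (pointIdeal x))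
    (g := toFrac) fun y => isUnit_iff_ne_zero.2 (toFrac_ne_zero (not_mem_ne_zero y.2))).comp
    (algebraMap _ (Localization.AtPrime (pointIdeal x)))

lemma localValue_mk (x : ProjectiveSpace k n) (f : HomogeneousLocalization.NumDenSameDeg
    (MvPolynomial.homogeneousSubmodule (Fin (n + 1)) k) (pointIdeal x).primeCompl) :
    localValue x (HomogeneousLocalization.mk f) = toFrac (f.num : MvPolynomial (Fin (n + 1)) k) /
      toFrac (f.den : MvPolynomial (Fin (n + 1)) k) := by
  rw [localValue, RingHom.comp_apply, HomogeneousLocalization.algebraMap_apply,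
    HomogeneousLocalization.val_mk, Localization.mk_eq_mk', IsLocalization.lift_mk'_spec,
    mul_div_cancel₀ _ (toFrac_ne_zero (not_mem_ne_zero f.den_mem))]

/-- The value of a section at a point, as an element of the field of fractions. -/
def evAt {U : (ProjectiveSpace k n).Opens} {x : ProjectiveSpace k n} (hx : x ∈ U) :
    Γ(ProjectiveSpace k n, U) →+* FracField k n :=
  (localValue x).comp (openToLocalization
    (MvPolynomial.homogeneousSubmodule (Fin (n + 1)) k) U x hx).hom

/-- The value of a section at the generic point. -/
def ev {U : (ProjectiveSpace k n).Opens} (hU : genPoint k n ∈ U) :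
    Γ(ProjectiveSpace k n, U) →+* FracField k n := evAt hU

lemma exists_fraction {U : (ProjectiveSpace k n).Opens} (s : Γ(ProjectiveSpace k n, U))
    {x : ProjectiveSpace k n} (hx : x ∈ U) :
    ∃ (V : (ProjectiveSpace k n).Opens) (_ : x ∈ V) (hVU : V ≤ U) (m : ℕ)
      (a b : MvPolynomial (Fin (n + 1)) k), a.IsHomogeneous m ∧ b.IsHomogeneous m ∧
      ∀ (y : ProjectiveSpace k n) (hy : y ∈ V), b ∉ pointIdeal y ∧
        evAt (hVU hy) s = toFrac a / toFrac b := by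
  obtain ⟨V, hxV, i, m, a, b, hb, h⟩ := s.2 ⟨x, hx⟩
  refine ⟨V, hxV, leOfHom i, m, a, b, (MvPolynomial.mem_homogeneousSubmodule _ _).1 a.2,
    (MvPolynomial.mem_homogeneousSubmodule _ _).1 b.2, fun y hy => ⟨hb ⟨y, hy⟩, ?_⟩⟩
  exact (congrArg (localValue y) (h ⟨y, hy⟩)).trans (localValue_mk y _)

/-- Near `x` the section is a single fraction, and that neighbourhood contains the generic point. -/
lemma evAt_eq_ev {U : (ProjectiveSpace k n).Opens} (s : Γ(ProjectiveSpace k n, U))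
    {x : ProjectiveSpace k n} (hx : x ∈ U) : evAt hx s = ev (genPoint_mem hx) s := by
  obtain ⟨V, hxV, hVU, m, a, b, -, -, h⟩ := exists_fraction s hx
  rw [(h x hxV).2, ev, (h _ (genPoint_mem hxV)).2]

lemma ev_mem {U : (ProjectiveSpace k n).Opens} (hU : genPoint k n ∈ U)
    (s : Γ(ProjectiveSpace k n, U)) {x : ProjectiveSpace k n} (hx : x ∈ U) :
    ev hU s ∈ regularAt (pointIdeal x) := by
  obtain ⟨V, hxV, hVU, m, a, b, ha, hb, h⟩ := exists_fraction s hx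
  rw [← evAt_eq_ev s hx, (h x hxV).2]
  exact div_mem_regularAt ha hb (h x hxV).1

lemma localValue_injective (x : ProjectiveSpace k n) : Function.Injective (localValue x) := by
  rw [injective_iff_map_eq_zero]
  intro y hy
  obtain ⟨f, rfl⟩ := HomogeneousLocalization.mk_surjective y
  rw [localValue_mk, div_eq_zero_iff, or_iff_left (toFrac_ne_zero (not_mem_ne_zero f.den_mem)),
    map_eq_zero_iff _ toFrac_injective] at hy
  exact HomogeneousLocalization.mk_eq_zero_of_num f (Subtype.ext hy)

lemma ev_injective {U : (ProjectiveSpace k n).Opens} (hU : genPoint k n ∈ U) :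
    Function.Injective (ev hU) := by
  intro s t hst
  refine Subtype.ext (funext fun x => localValue_injective x.1 ?_)
  exact (evAt_eq_ev s x.2).trans (hst.trans (evAt_eq_ev t x.2).symm)

lemma ev_res {U V : (ProjectiveSpace k n).Opens} (h : V ≤ U) (hV : genPoint k n ∈ V)
    (s : Γ(ProjectiveSpace k n, U)) : ev hV (resFun h s) = ev (h hV) s := rfl

/-- A compatible family of germs of fractions, as a section. -/
def sectionOfFraction {U : (ProjectiveSpace k n).Opens} (u : FracField k n)
    (s : ∀ x : U, HomogeneousLocalization.AtPrime
      (MvPolynomial.homogeneousSubmodule (Fin (n + 1)) k) (pointIdeal x.1))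
    (hs : ∀ x, localValue x.1 (s x) = u)
    (hu : ∀ x ∈ U, u ∈ regularAt (pointIdeal x)) : Γ(ProjectiveSpace k n, U) :=
  ⟨s, fun x => by
    obtain ⟨m, a, b, ha, hb, hbP, h⟩ := hu x.1 x.2
    refine ⟨U ⊓ basicOpen b, ⟨x.2, hbP⟩, homOfLE inf_le_left, m, ⟨a, ha⟩, ⟨b, hb⟩,
      fun y => y.2.2, fun y => ?_⟩
    refine localValue_injective y.1 ?_
    refine (hs ⟨y.1, y.2.1⟩).trans (h.trans ?_)
    exact (localValue_mk y.1 ⟨m, ⟨a, ha⟩, ⟨b, hb⟩, y.2.2⟩).symm⟩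

/-- A denominator that works at one point works on a neighbourhood, so pointwise regularity is
enough to define a section. Functions are constructed below through this criterion. -/
lemma exists_ev_eq {U : (ProjectiveSpace k n).Opens} (hU : genPoint k n ∈ U) {u : FracField k n}
    (hu : ∀ x ∈ U, u ∈ regularAt (pointIdeal x)) : ∃ s, ev hU s = u := by
  have hex : ∀ x : U, ∃ y, localValue x.1 y = u := by
    intro x
    obtain ⟨m, a, b, ha, hb, hbP, h⟩ := hu x.1 x.2
    exact ⟨HomogeneousLocalization.mk ⟨m, ⟨a, ha⟩, ⟨b, hb⟩, hbP⟩, by rw [localValue_mk, h]⟩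
  choose s hs using hex
  exact ⟨sectionOfFraction u s hs hu, hs ⟨_, hU⟩⟩

lemma ev_coord (i j : Fin (n + 1)) (hj : genPoint k n ∈ chart (k := k) j) :
    ev hj (coord i j) = toFrac (MvPolynomial.X i) / toFrac (MvPolynomial.X j) := by
  refine (localValue_mk _ _).trans ?_
  simp

attribute [local instance] sectionsAlgebra

/-- Stated for any `U` with `U = ⊤` so that the equality can be substituted away; it is applied to
`D₊(1)`. -/
lemma appTop_toSpecΓ_comp {X : Scheme.{u}} {U : X.Opens} (hU : U = ⊤) {R : CommRingCat.{u}}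
    (φ : R ⟶ Γ(X, U)) :
    ((Scheme.topIso X).inv ≫ (Scheme.isoOfEq X hU).inv ≫ U.toSpecΓ ≫ Spec.map φ).appTop =
      (Scheme.ΓSpecIso R).hom ≫ φ ≫ X.presheaf.map (homOfLE hU.ge).op := by
  subst hU
  have h1 : (Scheme.topIso X).inv ≫ (Scheme.isoOfEq X (rfl : (⊤ : X.Opens) = ⊤)).inv ≫
      Scheme.Opens.toSpecΓ ⊤ = X.toSpecΓ := by
    rw [Scheme.Opens.toSpecΓ_top, Scheme.isoOfEq_inv_ι_assoc, Scheme.toIso_inv_ι_assoc]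
  rw [reassoc_of% h1, Scheme.Hom.comp_appTop, Scheme.toSpecΓ_appTop, Scheme.ΓSpecIso_naturality]
  congr 1
  exact (Category.comp_id φ).symm.trans (by rw [← CategoryTheory.Functor.map_id]; rfl)

lemma basicOpen_one : basicOpen (1 : MvPolynomial (Fin (n + 1)) k) = ⊤ := Proj.basicOpen_one _

lemma ev_algebraMap {U : (ProjectiveSpace k n).Opens} (hU : genPoint k n ∈ U) (c : k) :
    ev hU (algebraMap k Γ(ProjectiveSpace k n, U) c) = toFrac (MvPolynomial.C c) := by
  have h1 : ((ProjectiveSpace k n) ↘ Spec (CommRingCat.of k)).appTop =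
      ((Scheme.topIso (ProjectiveSpace k n)).inv ≫
        (Scheme.isoOfEq (ProjectiveSpace k n) basicOpen_one).inv ≫ (basicOpen 1).toSpecΓ ≫
        Spec.map ((CommRingCat.ofHom (algebraMap k
          (MvPolynomial.homogeneousSubmodule (Fin (n + 1)) k 0)) ≫
          CommRingCat.ofHom (HomogeneousLocalization.fromZeroRingHom _ _) ≫
          Proj.awayToSection (MvPolynomial.homogeneousSubmodule (Fin (n + 1)) k) 1 :
          CommRingCat.of k ⟶ Γ(ProjectiveSpace k n, basicOpen 1)))).appTop := by
    congr 1
    change Proj.toSpecZero (MvPolynomial.homogeneousSubmodule (Fin (n + 1)) k) ≫ Spec.map _ = _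
    simp only [Proj.toSpecZero, Proj.basicOpenToSpec, Category.assoc, ← Spec.map_comp]
    rfl
  rw [appTop_toSpecΓ_comp] at h1
  change ev hU (resFun le_top (((ProjectiveSpace k n) ↘ Spec (CommRingCat.of k)).appTop.hom
    ((Scheme.ΓSpecIso (CommRingCat.of k)).inv.hom c))) = _
  rw [h1, ev_res]
  have h2 : (Scheme.ΓSpecIso (CommRingCat.of k)).hom.hom
      ((Scheme.ΓSpecIso (CommRingCat.of k)).inv.hom c) = c := by
    rw [← CommRingCat.comp_apply, Iso.inv_hom_id]
    rfl
  rw [CommRingCat.comp_apply]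
  erw [h2]
  refine (localValue_mk _ _).trans ?_
  simp
  rfl

instance : CompactSpace (ProjectiveSpace k n) := by
  refine ⟨?_⟩
  have h : (Set.univ : Set (ProjectiveSpace k n)) = ⋃ i, (chart (k := k) (n := n) i : Set _) :=
    (Set.eq_univ_of_forall fun x => Set.mem_iUnion.2 (exists_mem_chart x)).symm
  rw [h]
  exact isCompact_iUnion fun i => (Proj.isAffineOpen_basicOpen _ _
    ((MvPolynomial.mem_homogeneousSubmodule _ _).2 (MvPolynomial.isHomogeneous_X k i))
    one_pos).isCompact

/-- A fraction that is regular on `D₊(F)` is of the form `a / F ^ c`. -/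
lemma exists_eq_div_pow {F : MvPolynomial (Fin (n + 1)) k} {m : ℕ} (hF : F.IsHomogeneous m)
    (hm : 0 < m) (hF0 : F ≠ 0) {u : FracField k n}
    (hu : ∀ x ∈ basicOpen F, u ∈ regularAt (pointIdeal x)) :
    ∃ (c : ℕ) (a : MvPolynomial (Fin (n + 1)) k), a.IsHomogeneous (c * m) ∧
      u = toFrac a / toFrac F ^ c := by
  have hF' : F ∈ MvPolynomial.homogeneousSubmodule (Fin (n + 1)) k m :=
    (MvPolynomial.mem_homogeneousSubmodule _ _).2 hF
  obtain ⟨s, rfl⟩ := exists_ev_eq (genPoint_mem_basicOpen.2 hF0) hu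
  -- The ring of functions on `D₊(F)` is the degree-zero part of the localization at `F`; positivity
  -- of `m` enters here.
  obtain ⟨y, rfl⟩ : ∃ y, (Proj.awayToSection
      (MvPolynomial.homogeneousSubmodule (Fin (n + 1)) k) F).hom y = s := by
    refine ⟨(Proj.basicOpenIsoAway _ F hF' hm).inv.hom s, ?_⟩
    have := (Proj.basicOpenIsoAway _ F hF' hm).inv_hom_id
    exact congrArg (fun f => f.hom s) this
  obtain ⟨c, a, ha, rfl⟩ := HomogeneousLocalization.Away.mk_surjective _ hF' y
  refine ⟨c, a, (MvPolynomial.mem_homogeneousSubmodule _ _).1 ha, ?_⟩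
  refine (localValue_mk _ _).trans ?_
  simp

end Evaluation

/-! ### Sections of free sheaves of modules. -/

section FreeSheaf

open SheafOfModules CategoryTheory.Limits

variable {C : Type v} [Category.{w} C] {J : GrothendieckTopology C} {R : Sheaf J RingCat.{u}}
  {M N : SheafOfModules.{u} R}

lemma sum_val_app {I : Type*} (t : Finset I) (f : I → (M ⟶ N)) (Z : Cᵒᵖ) (y : M.val.obj Z) :
    (∑ i ∈ t, f i).val.app Z y = ∑ i ∈ t, (f i).val.app Z y := by
  classical
  induction t using Finset.induction_on with
  | empty => rfl
  | insert a t ha ih =>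
    rw [Finset.sum_insert ha, Finset.sum_insert ha, ← ih]
    rfl

/-- The value of a global section. -/
def sectionAt (s : M.sections) (Z : Cᵒᵖ) :
    M.val.obj Z := s.val Z

lemma unitHomEquiv_symm_app (s : M.sections) (Z : Cᵒᵖ) (c : R.obj.obj Z) :
    (M.unitHomEquiv.symm s).val.app Z c = c • sectionAt s Z := by
  have h1 := M.unitHomEquiv_apply_coe (M.unitHomEquiv.symm s) Z
  rw [Equiv.apply_symm_apply] at h1
  have h2 := ((M.unitHomEquiv.symm s).val.app Z).hom.map_smul c (1 : R.obj.obj Z)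
  refine (congrArg ((M.unitHomEquiv.symm s).val.app Z).hom (mul_one c).symm).trans ?_
  exact h2.trans (congrArg (fun y : M.val.obj Z => c • y) h1.symm)

variable [HasWeakSheafify J AddCommGrpCat.{u}] [J.WEqualsLocallyBijective AddCommGrpCat.{u}]

open Classical in
/-- The projections of a free sheaf of modules on its factors. -/
def freeProj {I : Type u} (i : I) : free (R := R) I ⟶ unit R :=
  Cofan.IsColimit.desc (isColimitFreeCofan I) fun j => if j = i then 𝟙 _ else 0

open Classical in
lemma ιFree_freeProj {I : Type u} (i j : I) :
    ιFree (R := R) j ≫ freeProj i = if j = i then 𝟙 _ else 0 :=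
  Cofan.IsColimit.fac (isColimitFreeCofan I) _ j

lemma sum_freeProj_ιFree {I : Type u} [Fintype I] :
    ∑ i, freeProj (R := R) i ≫ ιFree i = 𝟙 (free I) := by
  classical
  refine Cofan.IsColimit.hom_ext (isColimitFreeCofan I) _ _ fun j => ?_
  change ιFree j ≫ (∑ i, freeProj (R := R) i ≫ ιFree i : free I ⟶ free I) =
    ιFree j ≫ 𝟙 (free I)
  rw [Preadditive.comp_sum, Finset.sum_eq_single j]
  · rw [← Category.assoc, ιFree_freeProj, if_pos rfl, Category.id_comp, Category.comp_id]
  · intro i _ hij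
    rw [← Category.assoc, ιFree_freeProj, if_neg (Ne.symm hij), zero_comp]
  · intro h
    exact absurd (Finset.mem_univ j) h

/-- The inverse isomorphism followed by the projections gives morphisms `q i` dual to the sections.
The relations `q i ∘ s j = δ` and `∑ s i ∘ q i = 1` hold between sheaves and are then evaluated on
`Z`. -/
lemma bijective_of_isIso_free {I : Type u} [Fintype I] (s : I → M.sections)
    [IsIso (M.freeHomEquiv.symm s)] (Z : Cᵒᵖ) :
    Function.Bijective fun c : I → R.obj.obj Z => ∑ i, c i • sectionAt (s i) Z := by
  classical
  let π := M.freeHomEquiv.symm s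
  let q : ∀ i, M ⟶ unit R := fun i => inv π ≫ freeProj i
  have he : ∀ i, ιFree i ≫ π = M.unitHomEquiv.symm (s i) := fun i => by
    rw [← unitHomEquiv_symm_freeHomEquiv_apply, Equiv.apply_symm_apply]
  have hqe : ∀ i j, M.unitHomEquiv.symm (s j) ≫ q i = if j = i then 𝟙 _ else 0 := fun i j => by
    rw [← he, Category.assoc, IsIso.hom_inv_id_assoc, ιFree_freeProj]
  have hsum : ∑ i, q i ≫ M.unitHomEquiv.symm (s i) = 𝟙 M := by
    simp only [q, ← he, Category.assoc]
    rw [← Preadditive.comp_sum]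
    simp only [← Category.assoc]
    rw [← Preadditive.sum_comp, sum_freeProj_ιFree, Category.id_comp, IsIso.inv_hom_id]
  have hqs : ∀ i (c : I → R.obj.obj Z),
      (q i).val.app Z (∑ j, c j • sectionAt (s j) Z) = c i := by
    intro i c
    rw [map_sum, Finset.sum_eq_single i]
    · have := congrArg (fun f : unit R ⟶ unit R => f.val.app Z (c i)) (hqe i i)
      rw [if_pos rfl] at this
      rw [← unitHomEquiv_symm_app]
      exact this
    · intro j _ hj
      have := congrArg (fun f : unit R ⟶ unit R => f.val.app Z (c j)) (hqe i j)
      rw [if_neg hj] at this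
      rw [← unitHomEquiv_symm_app]
      exact this
    · intro h
      exact absurd (Finset.mem_univ i) h
  constructor
  · intro c c' h
    funext i
    rw [← hqs i c, ← hqs i c']
    exact congrArg _ h
  · intro y
    refine ⟨fun i => (q i).val.app Z y, ?_⟩
    have h1 := congrArg (fun f : M ⟶ M => f.val.app Z y) hsum
    refine Eq.trans ?_ h1
    rw [sum_val_app]
    refine Finset.sum_congr rfl fun i _ => ?_
    exact (unitHomEquiv_symm_app (s i) Z _).symm

end FreeSheaf

/-! ### Local bases from local freeness. -/

section LocalBasis

variable {X : Scheme.{u}}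

/-- The sections `e` of `F` over `W` freely generate `F` over `W`. -/
def IsBasisOn (F : X.Modules) {W : X.Opens} {r : ℕ} (e : Fin r → Γ(F, W)) : Prop :=
  ∀ (V : X.Opens) (h : V ≤ W), Function.Bijective
    fun c : Fin r → Γ(X, V) => ∑ l, c l • resSec F h (e l)

/-- The sheaf `F` has finite bases locally. -/
def HasLocalBases (F : X.Modules) : Prop :=
  ∀ x : X, ∃ (W : X.Opens) (_ : x ∈ W) (r : ℕ) (e : Fin r → Γ(F, W)), IsBasisOn F e

/-- The generators live on the slice site over `q.X i`; its objects `V → q.X i` give the bijectivity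
on every smaller open set. -/
lemma IsLocallyFreeOfFiniteRank.hasLocalBases {F : X.Modules}
    (hF : IsLocallyFreeOfFiniteRank F) : HasLocalBases F := by
  obtain ⟨q, hq, hfin⟩ := hF
  intro x
  have hcov := q.coversTop
  rw [Opens.coversTop_iff] at hcov
  obtain ⟨i, hi⟩ := TopologicalSpace.Opens.mem_iSup.1
    (show x ∈ iSup q.X from hcov ▸ trivial)
  have := (hfin.isFiniteType i).finite
  have := Fintype.ofFinite (q.generators i).I
  let φ := (Fintype.equivFin (q.generators i).I).symm
  refine ⟨q.X i, hi, Fintype.card (q.generators i).I, fun l =>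
    ((q.generators i).s (φ l)).val (op (Over.mk (𝟙 (q.X i)))), fun V h => ?_⟩
  have := hq.isIso i
  have key := bijective_of_isIso_free (q.generators i).s (op (Over.mk (homOfLE h)))
  have h1 : ∀ l, resSec F h (((q.generators i).s l).val (op (Over.mk (𝟙 (q.X i))))) =
      ((q.generators i).s l).val (op (Over.mk (homOfLE h))) := by
    intro l
    exact ((q.generators i).s l).property
      (Over.homMk (homOfLE h) : Over.mk (homOfLE h) ⟶ Over.mk (𝟙 (q.X i))).op
  simp only [h1]
  let t : (q.generators i).I → Γ(F, V) := fun l =>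
    sectionAt ((q.generators i).s l) (op (Over.mk (homOfLE h)))
  have key2 : Function.Bijective fun c : Fin (Fintype.card (q.generators i).I) → Γ(X, V) =>
      ∑ l, c (φ.symm l) • t l := key.comp (φ.arrowCongr (Equiv.refl Γ(X, V))).bijective
  convert key2 using 2 with c
  refine Fintype.sum_equiv φ _ _ fun l => ?_
  rw [Equiv.symm_apply_apply]
  rfl

lemma isZero_of_subsingleton {F : X.Modules} (h : ∀ U : X.Opens, Subsingleton Γ(F, U)) :
    Limits.IsZero F := by
  rw [Limits.IsZero.iff_id_eq_zero]
  refine Scheme.Modules.hom_ext _ _ fun U => ?_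
  ext s
  exact (h U).elim _ _

/-- If all local bases were empty, any two sections would agree locally and the sheaf would vanish.
-/
lemma exists_basis_of_not_isZero {F : X.Modules} (hF : HasLocalBases F)
    (h0 : ¬ Limits.IsZero F) :
    ∃ (x : X) (W : X.Opens) (_ : x ∈ W) (r : ℕ) (e : Fin r → Γ(F, W)), IsBasisOn F e ∧ 0 < r := by
  by_contra hcon
  push Not at hcon
  refine h0 (isZero_of_subsingleton fun U => ⟨fun s t => ?_⟩)
  choose W hW r e he using hF
  refine resSec_ext F (fun x : U => U ⊓ W x.1) (fun x => inf_le_left)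
    (fun x hx => TopologicalSpace.Opens.mem_iSup.2 ⟨⟨x, hx⟩, hx, hW x⟩) fun x => ?_
  have hr : r x.1 = 0 := Nat.le_zero.1 (hcon x.1 (W x.1) (hW x.1) _ (e x.1) (he x.1))
  have : IsEmpty (Fin (r x.1)) := by rw [hr]; infer_instance
  obtain ⟨c, hc⟩ := (he x.1 (U ⊓ W x.1) inf_le_right).2 (resSec F inf_le_left s)
  obtain ⟨c', hc'⟩ := (he x.1 (U ⊓ W x.1) inf_le_right).2 (resSec F inf_le_left t)
  rw [← hc, ← hc']
  simp

end LocalBasis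

/-! ### Coordinates in a local basis. -/

section LocalCoordinates

variable {X : Scheme.{u}} {F : X.Modules} {W : X.Opens} {r : ℕ} {e : Fin r → Γ(F, W)}

/-- The coordinates of a section with respect to a local basis. -/
def IsBasisOn.coords (he : IsBasisOn F e) {V : X.Opens} (h : V ≤ W) (s : Γ(F, V)) :
    Fin r → Γ(X, V) :=
  ((he V h).2 s).choose

lemma IsBasisOn.sum_coords (he : IsBasisOn F e) {V : X.Opens} (h : V ≤ W) (s : Γ(F, V)) :
    ∑ l, he.coords h s l • resSec F h (e l) = s :=
  ((he V h).2 s).choose_spec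

lemma IsBasisOn.coords_eq (he : IsBasisOn F e) {V : X.Opens} (h : V ≤ W) {s : Γ(F, V)}
    {c : Fin r → Γ(X, V)} (hc : ∑ l, c l • resSec F h (e l) = s) : he.coords h s = c :=
  (he V h).1 ((he.sum_coords h s).trans hc.symm)

lemma IsBasisOn.coords_res (he : IsBasisOn F e) {U V : X.Opens} (h : U ≤ W) (h' : V ≤ U)
    (s : Γ(F, U)) : he.coords (h'.trans h) (resSec F h' s) =
      fun l => resFun h' (he.coords h s l) := by
  refine he.coords_eq _ ?_
  conv_rhs => rw [← he.sum_coords h s, map_sum]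
  simp only [resSec_smul, resSec_resSec]

lemma IsBasisOn.coords_add (he : IsBasisOn F e) {V : X.Opens} (h : V ≤ W) (s t : Γ(F, V)) :
    he.coords h (s + t) = he.coords h s + he.coords h t := by
  refine he.coords_eq _ ?_
  simp only [Pi.add_apply, add_smul, Finset.sum_add_distrib, he.sum_coords]

lemma IsBasisOn.coords_smul (he : IsBasisOn F e) {V : X.Opens} (h : V ≤ W) (b : Γ(X, V))
    (s : Γ(F, V)) : he.coords h (b • s) = fun l => b * he.coords h s l := by
  refine he.coords_eq _ ?_
  simp only [mul_smul, ← Finset.smul_sum, he.sum_coords]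

lemma IsBasisOn.coords_basis (he : IsBasisOn F e) {V : X.Opens} (h : V ≤ W) (m : Fin r) :
    he.coords h (resSec F h (e m)) = Pi.single m 1 := by
  refine he.coords_eq _ ?_
  rw [Finset.sum_eq_single m]
  · simp
  · intro l _ hl
    simp [hl]
  · intro hm
    exact absurd (Finset.mem_univ m) hm

end LocalCoordinates

/-! ### Coordinates at the generic point. -/

section GenericCoordinates

variable {k : Type u} [Field k] {n : ℕ} {F : (ProjectiveSpace k n).Modules}
  {V₀ : (ProjectiveSpace k n).Opens} {r : ℕ} {e : Fin r → Γ(F, V₀)}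

lemma genPoint_mem_inf {U V : (ProjectiveSpace k n).Opens} (hU : genPoint k n ∈ U)
    (hV : genPoint k n ∈ V) : genPoint k n ∈ U ⊓ V := ⟨hU, hV⟩

/-- The coordinates of a section at the generic point. -/
def IsBasisOn.genCoords (he : IsBasisOn F e) (hη : genPoint k n ∈ V₀)
    {U : (ProjectiveSpace k n).Opens} (hU : genPoint k n ∈ U) : Γ(F, U) →+ (Fin r → FracField k n) :=
  AddMonoidHom.mk' (fun s l => ev (genPoint_mem_inf hU hη)
    (he.coords inf_le_right (resSec F inf_le_left s) l)) fun s t => by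
      funext l
      rw [map_add, he.coords_add, Pi.add_apply, map_add, Pi.add_apply]

lemma IsBasisOn.genCoords_apply (he : IsBasisOn F e) (hη : genPoint k n ∈ V₀)
    {U : (ProjectiveSpace k n).Opens} (hU : genPoint k n ∈ U) (s : Γ(F, U)) (l : Fin r) :
    he.genCoords hη hU s l = ev (genPoint_mem_inf hU hη)
      (he.coords inf_le_right (resSec F inf_le_left s) l) := rfl

lemma IsBasisOn.genCoords_smul (he : IsBasisOn F e) (hη : genPoint k n ∈ V₀)
    {U : (ProjectiveSpace k n).Opens} (hU : genPoint k n ∈ U) (b : Γ(ProjectiveSpace k n, U))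
    (s : Γ(F, U)) (l : Fin r) :
    he.genCoords hη hU (b • s) l = ev hU b * he.genCoords hη hU s l := by
  rw [genCoords_apply, genCoords_apply, resSec_smul, coords_smul, map_mul, ev_res]

lemma IsBasisOn.genCoords_res (he : IsBasisOn F e) (hη : genPoint k n ∈ V₀)
    {U V : (ProjectiveSpace k n).Opens} (h : V ≤ U) (hV : genPoint k n ∈ V) (s : Γ(F, U)) :
    he.genCoords hη hV (resSec F h s) = he.genCoords hη (h hV) s := by
  funext l
  have h1 := congrFun (he.coords_res (inf_le_right : U ⊓ V₀ ≤ V₀) (inf_le_inf_right V₀ h)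
    (resSec F inf_le_left s)) l
  rw [resSec_resSec] at h1
  rw [genCoords_apply, genCoords_apply, resSec_resSec]
  refine (congrArg _ h1).trans ?_
  rw [ev_res]

lemma IsBasisOn.genCoords_eq_coords (he : IsBasisOn F e) (hη : genPoint k n ∈ V₀)
    {U : (ProjectiveSpace k n).Opens} (hU : genPoint k n ∈ U) (h : U ≤ V₀) (s : Γ(F, U))
    (l : Fin r) : he.genCoords hη hU s l = ev hU (he.coords h s l) := by
  rw [genCoords_apply, he.coords_res h, ev_res]

lemma IsBasisOn.genCoords_sum (he : IsBasisOn F e) (hη : genPoint k n ∈ V₀)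
    {U W : (ProjectiveSpace k n).Opens} (hU : genPoint k n ∈ U) (hUW : U ≤ W) {r' : ℕ}
    (b : Fin r' → Γ(F, W)) (c : Fin r' → Γ(ProjectiveSpace k n, U)) (m : Fin r) :
    he.genCoords hη hU (∑ l, c l • resSec F hUW (b l)) m =
      ∑ l, ev hU (c l) * he.genCoords hη (hUW hU) (b l) m := by
  rw [map_sum, Finset.sum_apply]
  refine Finset.sum_congr rfl fun l _ => ?_
  rw [genCoords_smul, genCoords_res]

/-- Sections of a locally free sheaf are determined by their coordinates at the generic point. -/
lemma IsBasisOn.genCoords_injective (he : IsBasisOn F e) (hη : genPoint k n ∈ V₀)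
    (hF : HasLocalBases F) {U : (ProjectiveSpace k n).Opens} {s t : Γ(F, U)}
    (h : ∀ hU : genPoint k n ∈ U, he.genCoords hη hU s = he.genCoords hη hU t) : s = t := by
  choose W hW r' b hb using hF
  refine resSec_ext F (fun x : U => U ⊓ W x.1) (fun x => inf_le_left)
    (fun x hx => TopologicalSpace.Opens.mem_iSup.2 ⟨⟨x, hx⟩, hx, hW x⟩) fun x => ?_
  have hU : genPoint k n ∈ U := genPoint_mem x.2
  have hV : genPoint k n ∈ U ⊓ W x.1 := genPoint_mem_inf hU (genPoint_mem (hW x.1))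
  -- Over `U ⊓ V₀` the generic coordinates determine the section. Near a point outside `V₀`, the
  -- coordinates in a basis there are functions, and these are determined by their restriction to
  -- `V₀`.
  have h1 : resSec F inf_le_left s = (resSec F inf_le_left t : Γ(F, U ⊓ V₀)) := by
    rw [← he.sum_coords inf_le_right (resSec F inf_le_left s),
      ← he.sum_coords inf_le_right (resSec F inf_le_left t)]
    congr 1
    funext l
    rw [ev_injective (genPoint_mem_inf hU hη) (congrFun (h hU) l)]
  have h2 : resSec F (le_inf (inf_le_left.trans inf_le_left) inf_le_right :
      (U ⊓ W x.1) ⊓ V₀ ≤ U ⊓ V₀) (resSec F inf_le_left s) =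
      resSec F (le_inf (inf_le_left.trans inf_le_left) inf_le_right :
      (U ⊓ W x.1) ⊓ V₀ ≤ U ⊓ V₀) (resSec F inf_le_left t) := by rw [h1]
  rw [resSec_resSec, resSec_resSec,
    ← resSec_resSec F (inf_le_left : U ⊓ W x.1 ≤ U) (inf_le_left : (U ⊓ W x.1) ⊓ V₀ ≤ _),
    ← resSec_resSec F (inf_le_left : U ⊓ W x.1 ≤ U) (inf_le_left : (U ⊓ W x.1) ⊓ V₀ ≤ _)] at h2
  have h3 := congrArg ((hb x.1).coords (inf_le_left.trans inf_le_right)) h2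
  rw [(hb x.1).coords_res inf_le_right, (hb x.1).coords_res inf_le_right] at h3
  rw [← (hb x.1).sum_coords inf_le_right (resSec F inf_le_left s),
    ← (hb x.1).sum_coords inf_le_right (resSec F inf_le_left t)]
  congr 1
  funext l
  have h4 := congrArg (ev (genPoint_mem_inf hV hη)) (congrFun h3 l)
  rw [ev_res, ev_res] at h4
  rw [ev_injective _ h4]

lemma IsBasisOn.genCoords_mem (he : IsBasisOn F e) (hη : genPoint k n ∈ V₀)
    {U : (ProjectiveSpace k n).Opens} (hU : genPoint k n ∈ U) (s : Γ(F, U)) (l : Fin r)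
    {x : ProjectiveSpace k n} (hx : x ∈ U ⊓ V₀) :
    he.genCoords hη hU s l ∈ regularAt (pointIdeal x) :=
  ev_mem _ _ hx

/-- The inverse of the matrix of coordinates of a local basis. -/
lemma IsBasisOn.exists_inverse (he : IsBasisOn F e) (hη : genPoint k n ∈ V₀)
    {W : (ProjectiveSpace k n).Opens} (hW : genPoint k n ∈ W) {r' : ℕ} {b : Fin r' → Γ(F, W)}
    (hb : IsBasisOn F b) (m : Fin r) :
    ∃ g : Fin r' → FracField k n, (∀ l, ∀ x ∈ W ⊓ V₀, g l ∈ regularAt (pointIdeal x)) ∧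
      ∀ m', ∑ l, g l * he.genCoords hη hW (b l) m' = if m' = m then 1 else 0 := by
  have hWV : genPoint k n ∈ W ⊓ V₀ := genPoint_mem_inf hW hη
  -- The `g l` are the coordinates of `e m` in the basis `b` over `W ⊓ V₀`; reading `e m = ∑ g l • b
  -- l` in the basis `e` gives the identity.
  refine ⟨fun l => ev hWV (hb.coords inf_le_left (resSec F inf_le_right (e m)) l),
    fun l x hx => ev_mem _ _ hx, fun m' => ?_⟩
  rw [← he.genCoords_sum hη hWV inf_le_left, hb.sum_coords, he.genCoords_eq_coords _ _ inf_le_right,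
    he.coords_basis, Pi.single_apply]
  split_ifs
  exacts [map_one _, map_zero _]

end GenericCoordinates

/-! ### Cancelling poles: the operator preserves sections. -/

section LocalExistence

variable {k : Type u} [Field k] {n : ℕ}

/-- On `D₊(wf)` one has `g = a / (wf) ^ c₀`, and `f ^ c` cancels `f ^ c₀` once `c ≥ c₀`. The power
of `x_i` only restores degree zero: it is invertible on `D₊(w)`. -/
lemma eventually_mem_regularAt {w f : MvPolynomial (Fin (n + 1)) k} {m d : ℕ}
    (hw : w.IsHomogeneous m) (hm : 0 < m) (hw0 : w ≠ 0) (hf : f.IsHomogeneous d) (hf0 : f ≠ 0)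
    {i : Fin (n + 1)} (hwi : basicOpen w ≤ chart i) {g : FracField k n}
    (hg : ∀ y ∈ basicOpen w ⊓ basicOpen f, g ∈ regularAt (pointIdeal y)) :
    ∀ᶠ c in Filter.atTop, ∀ y ∈ basicOpen w,
      g * (toFrac f / toFrac (MvPolynomial.X i) ^ d) ^ c ∈ regularAt (pointIdeal y) := by
  rw [← basicOpen_mul] at hg
  obtain ⟨c₀, a, ha, rfl⟩ := exists_eq_div_pow (hw.mul hf) (by omega) (mul_ne_zero hw0 hf0) hg
  filter_upwards [Filter.eventually_ge_atTop c₀] with c hc y hy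
  have hi : MvPolynomial.X i ∉ pointIdeal y := hwi hy
  have hXi := toFrac_ne_zero (not_mem_ne_zero hi)
  have hf1 := toFrac_ne_zero hf0
  have hw1 := toFrac_ne_zero hw0
  have hX : (MvPolynomial.X i ^ d : MvPolynomial (Fin (n + 1)) k).IsHomogeneous d := by
    simpa using (MvPolynomial.isHomogeneous_X k i).pow d
  have hXd : (MvPolynomial.X i ^ d : MvPolynomial (Fin (n + 1)) k) ∉ pointIdeal y :=
    fun h => hi (Ideal.IsPrime.mem_of_pow_mem inferInstance _ h)
  have h1 : toFrac f / toFrac (MvPolynomial.X i) ^ d ∈ regularAt (pointIdeal y) := by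
    rw [← map_pow]
    exact div_mem_regularAt hf hX hXd
  have hden : (w ^ c₀ * (MvPolynomial.X i ^ d) ^ c₀).IsHomogeneous (c₀ * (m + d)) := by
    have := (hw.pow c₀).mul (hX.pow c₀)
    rwa [show m * c₀ + d * c₀ = c₀ * (m + d) by ring] at this
  have h2 : toFrac a / toFrac (w ^ c₀ * (MvPolynomial.X i ^ d) ^ c₀) ∈
      regularAt (pointIdeal y) := by
    refine div_mem_regularAt ha hden fun h => ?_
    rcases Ideal.IsPrime.mem_or_mem inferInstance h with h | h
    · exact mem_basicOpen.1 hy (Ideal.IsPrime.mem_of_pow_mem inferInstance _ h)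
    · exact hXd (Ideal.IsPrime.mem_of_pow_mem inferInstance _ h)
  convert mul_mem h2 (pow_mem h1 (c - c₀)) using 1
  obtain ⟨j, rfl⟩ := Nat.exists_eq_add_of_le hc
  rw [Nat.add_sub_cancel_left, pow_add, ← mul_assoc]
  congr 1
  simp only [map_mul, map_pow, mul_pow, div_pow]
  field_simp

/-- The operator `γ ^ c ∂ γ ^ c` on the function field, where `∂` is the Hasse derivative of order
`N` in the direction `q` of the chart `p`. -/
def conjOp (q p : Fin (n + 1)) (γ : FracField k n) (N : ℕ) : FracField k n →+ FracField k n where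
  toFun u := γ * PowerSeries.coeff N (shift q p (γ * u))
  map_zero' := by simp
  map_add' u v := by rw [mul_add, map_add, map_add, mul_add]

lemma conjOp_apply (q p : Fin (n + 1)) (γ : FracField k n) (N : ℕ) (u : FracField k n) :
    conjOp q p γ N u = γ * PowerSeries.coeff N (shift q p (γ * u)) := rfl

/-- Seen from the chart `i`, each `γ` is `(x_i / x_p) ^ (dc)` times `(f / x_i ^ d) ^ c`. The second
factors clear the poles of `u` and `g`; the two first factors are absorbed by the `(x_p / x_i) ^ N`
coming from the derivative, because `N ≥ 2dc`. -/
lemma conjOp_mul_mem {q p : Fin (n + 1)} (hpq : p ≠ q) {P : Ideal (MvPolynomial (Fin (n + 1)) k)}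
    [P.IsPrime] {i : Fin (n + 1)} (hi : MvPolynomial.X i ∉ P) {f : MvPolynomial (Fin (n + 1)) k}
    {c d N : ℕ} (hN : 2 * (d * c) ≤ N) {u g : FracField k n}
    (hu : u * (toFrac f / toFrac (MvPolynomial.X i) ^ d) ^ c ∈ regularAt P)
    (hg : g * (toFrac f / toFrac (MvPolynomial.X i) ^ d) ^ c ∈ regularAt P) :
    conjOp q p ((toFrac f / toFrac (MvPolynomial.X p) ^ d) ^ c) N u * g ∈ regularAt P := by
  have hXi : toFrac (k := k) (MvPolynomial.X i) ≠ 0 := toFrac_ne_zero (MvPolynomial.X_ne_zero i)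
  have hXp : toFrac (k := k) (MvPolynomial.X p) ≠ 0 := toFrac_ne_zero (MvPolynomial.X_ne_zero p)
  have hγ : (toFrac f / toFrac (MvPolynomial.X p) ^ d) ^ c =
      (toFrac (MvPolynomial.X i) / toFrac (MvPolynomial.X p)) ^ (d * c) *
        (toFrac f / toFrac (MvPolynomial.X i) ^ d) ^ c := by
    rw [pow_mul, ← mul_pow, div_pow (toFrac (MvPolynomial.X i)), mul_comm,
      div_mul_div_cancel₀ (pow_ne_zero d hXi)]
  obtain ⟨v, hv, h⟩ := coeff_shift_pole hpq hu (i := i) (d * c) N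
  have h1 : (toFrac f / toFrac (MvPolynomial.X p) ^ d) ^ c * u =
      (toFrac (MvPolynomial.X i) / toFrac (MvPolynomial.X p)) ^ (d * c) *
        (u * (toFrac f / toFrac (MvPolynomial.X i) ^ d) ^ c) := by
    rw [hγ]
    ring
  have hh : toFrac (MvPolynomial.X p) / toFrac (MvPolynomial.X i) ∈ regularAt P :=
    div_mem_regularAt (MvPolynomial.isHomogeneous_X k p) (MvPolynomial.isHomogeneous_X k i) hi
  rw [conjOp_apply, h1, h, hγ]
  convert mul_mem (mul_mem (pow_mem hh (N - 2 * (d * c))) hg) hv using 1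
  obtain ⟨j, rfl⟩ := Nat.exists_eq_add_of_le hN
  have h2 : (toFrac (k := k) (MvPolynomial.X i) / toFrac (MvPolynomial.X p)) ^ (d * c) *
      (toFrac (MvPolynomial.X p) / toFrac (MvPolynomial.X i)) ^ (d * c) = 1 := by
    rw [← mul_pow, div_mul_div_cancel₀ hXp, div_self hXi, one_pow]
  rw [Nat.add_sub_cancel_left, pow_add, two_mul, pow_add]
  -- If `h2` reads `AB = 1`, the needed relation is `A²B² = 1`, whence the factor `AB + 1`.
  linear_combination ((toFrac (MvPolynomial.X p) / toFrac (MvPolynomial.X i)) ^ j *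
    g * (toFrac f / toFrac (MvPolynomial.X i) ^ d) ^ c * v) *
    ((toFrac (k := k) (MvPolynomial.X i) / toFrac (MvPolynomial.X p)) ^ (d * c) *
      (toFrac (MvPolynomial.X p) / toFrac (MvPolynomial.X i)) ^ (d * c) + 1) * h2

variable {F₁ F₂ : (ProjectiveSpace k n).Modules}
  {V₁ V₂ : (ProjectiveSpace k n).Opens} {r₁ r₂ : ℕ} {e₁ : Fin r₁ → Γ(F₁, V₁)}
  {e₂ : Fin r₂ → Γ(F₂, V₂)}

/-- Write `e₂ m₂ = ∑ g l • b₂ l` in a basis near `x`; the section sought has coefficients `conjOp(…)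
* g l` in that basis, and these are regular by `conjOp_mul_mem`. The bound on `c` depends on `x` but
not on `N`, `U` or `s`. -/
lemma exists_local_section (he₁ : IsBasisOn F₁ e₁) (he₂ : IsBasisOn F₂ e₂)
    (h₁ : genPoint k n ∈ V₁) (h₂ : genPoint k n ∈ V₂) (hF₁ : HasLocalBases F₁)
    (hF₂ : HasLocalBases F₂) (m₁ : Fin r₁) (m₂ : Fin r₂) {q p : Fin (n + 1)} (hpq : p ≠ q)
    {f : MvPolynomial (Fin (n + 1)) k} {d : ℕ} (hf : f.IsHomogeneous d) (hf0 : f ≠ 0)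
    (hfV : basicOpen f ≤ V₁ ⊓ V₂) (x : ProjectiveSpace k n) :
    ∃ (B : (ProjectiveSpace k n).Opens) (_ : x ∈ B), ∀ᶠ c in Filter.atTop,
      ∀ N, 2 * (d * c) ≤ N → ∀ U ≤ B, ∀ (hU : genPoint k n ∈ U) (s : Γ(F₁, U)),
      ∃ t : Γ(F₂, U), he₂.genCoords h₂ hU t = Pi.single m₂
        (conjOp q p ((toFrac f / toFrac (MvPolynomial.X p) ^ d) ^ c) N
          (he₁.genCoords h₁ hU s m₁)) := by
  obtain ⟨W₁, hxW₁, s₁, b₁, hb₁⟩ := hF₁ x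
  obtain ⟨W₂, hxW₂, s₂, b₂, hb₂⟩ := hF₂ x
  obtain ⟨i, hxi⟩ := exists_mem_chart x
  obtain ⟨m, w, hw, hxw, hwW⟩ := exists_basicOpen_le (U := W₁ ⊓ W₂) ⟨hxW₁, hxW₂⟩
  -- The extra factor `x_i` puts the neighbourhood inside the chart `i` and makes the degree of the
  -- equation positive.
  have hB : basicOpen (w * MvPolynomial.X i) ≤ basicOpen w := basicOpen_mul w _ ▸ inf_le_left
  have hBi : basicOpen (w * MvPolynomial.X i) ≤ chart i := basicOpen_mul w _ ▸ inf_le_right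
  have hxB : x ∈ basicOpen (w * MvPolynomial.X i) := by
    rw [basicOpen_mul]
    exact ⟨hxw, hxi⟩
  have hw0 : w * MvPolynomial.X i ≠ 0 := not_mem_ne_zero (mem_basicOpen.1 hxB)
  have hwh := hw.mul (MvPolynomial.isHomogeneous_X k i)
  have hη := genPoint_mem hxB
  have hW₁ := genPoint_mem hxW₁
  have hW₂ := genPoint_mem hxW₂
  have hBW₁ : basicOpen (w * MvPolynomial.X i) ≤ W₁ := hB.trans (hwW.trans inf_le_left)
  have hBW₂ : basicOpen (w * MvPolynomial.X i) ≤ W₂ := hB.trans (hwW.trans inf_le_right)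
  obtain ⟨g, hg, hginv⟩ := he₂.exists_inverse h₂ hW₂ hb₂ m₂
  refine ⟨_, hxB, ?_⟩
  have hev₁ := Filter.eventually_all.2 fun l =>
    eventually_mem_regularAt hwh (Nat.succ_pos m) hw0 hf hf0 hBi
      (g := he₁.genCoords h₁ hW₁ (b₁ l) m₁)
      fun y hy => he₁.genCoords_mem h₁ hW₁ _ _ ⟨hBW₁ hy.1, (hfV hy.2).1⟩
  have hev₂ := Filter.eventually_all.2 fun l =>
    eventually_mem_regularAt hwh (Nat.succ_pos m) hw0 hf hf0 hBi
      (g := g l) fun y hy => hg l y ⟨hBW₂ hy.1, (hfV hy.2).2⟩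
  filter_upwards [hev₁, hev₂] with c hc₁ hc₂ N hN U hUB hU s
  have hs : ∀ y ∈ U, he₁.genCoords h₁ hU s m₁ *
      (toFrac f / toFrac (MvPolynomial.X i) ^ d) ^ c ∈ regularAt (pointIdeal y) := by
    intro y hy
    rw [← hb₁.sum_coords (hUB.trans hBW₁) s, he₁.genCoords_sum h₁ hU, Finset.sum_mul]
    refine sum_mem fun l _ => ?_
    rw [mul_assoc]
    exact mul_mem (ev_mem hU _ hy) (hc₁ l y (hUB hy))
  have hex : ∀ l, ∃ t : Γ(ProjectiveSpace k n, U), ev hU t =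
      conjOp q p ((toFrac f / toFrac (MvPolynomial.X p) ^ d) ^ c) N
        (he₁.genCoords h₁ hU s m₁) * g l := fun l =>
    exists_ev_eq hU fun y hy => conjOp_mul_mem hpq (mem_basicOpen.1 (hBi (hUB hy))) hN (hs y hy) (hc₂ l y (hUB hy))
  choose t ht using hex
  refine ⟨∑ l, t l • resSec F₂ (hUB.trans hBW₂) (b₂ l), ?_⟩
  funext m'
  rw [he₂.genCoords_sum h₂ hU]
  simp only [ht, mul_assoc]
  rw [← Finset.mul_sum, hginv, Pi.single_apply]
  split_ifs <;> simp

lemma exists_uniform_section (he₁ : IsBasisOn F₁ e₁) (he₂ : IsBasisOn F₂ e₂)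
    (h₁ : genPoint k n ∈ V₁) (h₂ : genPoint k n ∈ V₂) (hF₁ : HasLocalBases F₁)
    (hF₂ : HasLocalBases F₂) (m₁ : Fin r₁) (m₂ : Fin r₂) {q p : Fin (n + 1)} (hpq : p ≠ q) :
    ∃ (γ : FracField k n) (N₀ : ℕ), γ ≠ 0 ∧ ∀ N, N₀ ≤ N →
      ∀ (U : (ProjectiveSpace k n).Opens) (s : Γ(F₁, U)), ∃ t : Γ(F₂, U),
        ∀ hU : genPoint k n ∈ U, he₂.genCoords h₂ hU t =
          Pi.single m₂ (conjOp q p γ N (he₁.genCoords h₁ hU s m₁)) := by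
  obtain ⟨d, f, hf, hηf, hfV⟩ := exists_basicOpen_le (U := V₁ ⊓ V₂) ⟨h₁, h₂⟩
  have hf0 : f ≠ 0 := genPoint_mem_basicOpen.1 hηf
  choose B hxB hB using exists_local_section he₁ he₂ h₁ h₂ hF₁ hF₂ m₁ m₂ hpq hf hf0 hfV
  -- Finitely many neighbourhoods suffice, so one exponent `c` serves them all; `γ` and the bound `2
  -- * (d * c)` are thereby fixed before `N`.
  obtain ⟨T, hT⟩ := isCompact_univ.elim_nhds_subcover (fun x => (B x : Set (ProjectiveSpace k n)))
    fun x _ => (B x).isOpen.mem_nhds (hxB x)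
  obtain ⟨c, hc⟩ := ((Filter.eventually_all_finset T).2 fun x _ => hB x).exists
  refine ⟨(toFrac f / toFrac (MvPolynomial.X p) ^ d) ^ c, 2 * (d * c), pow_ne_zero _
    (div_ne_zero (toFrac_ne_zero hf0) (pow_ne_zero _ (toFrac_ne_zero (MvPolynomial.X_ne_zero p)))),
    fun N hN U s => ?_⟩
  have hcov : ∀ y : U, ∃ x ∈ T, y.1 ∈ B x := fun y => by
    simpa using hT.2 (Set.mem_univ y.1)
  choose b hbT hb using hcov
  have hη : ∀ y : U, genPoint k n ∈ U ⊓ B (b y) := fun y => genPoint_mem ⟨y.2, hb y⟩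
  choose t ht using fun y : U => hc (b y) (hbT y) N hN (U ⊓ B (b y)) inf_le_right (hη y)
    (resSec F₁ inf_le_left s)
  -- The local sections agree on overlaps because their generic coordinates are prescribed.
  obtain ⟨t', ht'⟩ := resSec_glue F₂ (fun y : U => U ⊓ B (b y)) (V := U) (fun y => inf_le_left)
    (fun y hy => TopologicalSpace.Opens.mem_iSup.2 ⟨⟨y, hy⟩, hy, hb ⟨y, hy⟩⟩) t fun y z => by
      refine he₂.genCoords_injective h₂ hF₂ fun hU => ?_
      rw [he₂.genCoords_res, he₂.genCoords_res, ht, ht, he₁.genCoords_res, he₁.genCoords_res]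
  refine ⟨t', fun hU => ?_⟩
  rw [← he₂.genCoords_res h₂ inf_le_left (hη ⟨_, hU⟩), ht', ht, he₁.genCoords_res]

end LocalExistence

/-! ### Linear maps out of jet modules. -/

section JetHom

variable {A : Type u} {B : Type v} {M : Type w} [CommRing A] [CommRing B] [Algebra A B]
  [AddCommGroup M] [Module A M] [Module B M] [IsScalarTower A B M]
  {M' : Type*} [AddCommGroup M'] [Module B M']

lemma jet_tmul (N : ℕ) (b : B) (m : M) :
    Jet.mk A B M N (b ⊗ₜ m) = b • Jet.d A B M N m := by
  change _ = b • Jet.mk A B M N (1 ⊗ₜ m)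
  rw [← _root_.map_smul, TensorProduct.smul_tmul', smul_eq_mul, mul_one]

lemma Jet.addHom_ext {N : ℕ} {G : Type*} [AddCommGroup G] {f g : Jet A B M N →+ G}
    (h : ∀ (b : B) (m : M), f (b • Jet.d A B M N m) = g (b • Jet.d A B M N m)) : f = g := by
  ext x
  obtain ⟨x, rfl⟩ := Submodule.mkQ_surjective _ x
  change f (Jet.mk A B M N x) = g (Jet.mk A B M N x)
  induction x with
  | zero => simp
  | add x y hx hy => rw [map_add, map_add, map_add, hx, hy]
  | tmul b m => rw [jet_tmul, h]

/-- The projection from a jet module to a jet module of lower order. -/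
def Jet.proj {K N : ℕ} (h : K ≤ N) : Jet A B M N →ₗ[B] Jet A B M K :=
  (jetRel A B M N).mapQ (jetRel A B M K) LinearMap.id (by
    refine Submodule.span_le.2 ?_
    rintro _ ⟨t, ht, x, rfl⟩
    exact Submodule.subset_span ⟨t, Ideal.pow_le_pow_right (by omega) ht, x, rfl⟩)

lemma Jet.proj_d {K N : ℕ} (h : K ≤ N) (m : M) :
    Jet.proj h (Jet.d A B M N m) = Jet.d A B M K m := rfl

variable [Module A M'] [IsScalarTower A B M']

/-- The linear map on jets defined by an operator which vanishes on the relations. -/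
def Jet.lift {N : ℕ} (D : M →ₗ[A] M')
    (hD : ∀ t ∈ (KaehlerDifferential.ideal A B) ^ (N + 1), ∀ m : M,
      D.liftBaseChange B (biAct A B M t (1 ⊗ₜ m)) = 0) : Jet A B M N →ₗ[B] M' :=
  (jetRel A B M N).liftQ (D.liftBaseChange B) (by
    refine Submodule.span_le.2 ?_
    rintro _ ⟨t, ht, x, rfl⟩
    change D.liftBaseChange B (biAct A B M t x) = 0
    induction x with
    | zero => simp
    | add x y hx hy => rw [map_add, map_add, hx, hy, add_zero]
    | tmul c m =>
      have h1 : (c ⊗ₜ m : B ⊗[A] M) = biAct A B M (c ⊗ₜ 1) (1 ⊗ₜ m) := by simp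
      rw [h1, ← Module.End.mul_apply, ← map_mul]
      exact hD _ (Ideal.mul_mem_right _ _ ht) m)

lemma Jet.lift_d {N : ℕ} (D : M →ₗ[A] M')
    (hD : ∀ t ∈ (KaehlerDifferential.ideal A B) ^ (N + 1), ∀ m : M,
      D.liftBaseChange B (biAct A B M t (1 ⊗ₜ m)) = 0) (m : M) :
    Jet.lift D hD (Jet.d A B M N m) = D m := by
  change D.liftBaseChange B (1 ⊗ₜ m) = D m
  simp

/-- A factorization of `D` through jets is forced to be its base change, so a bound on the order can
be refuted by a computation with `D` alone. -/
lemma liftBaseChange_eq {N : ℕ} (D : M →ₗ[A] M') (φ : Jet A B M N →ₗ[B] M')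
    (h : ∀ m, φ (Jet.d A B M N m) = D m) (x : B ⊗[A] M) :
    D.liftBaseChange B x = φ (Jet.mk A B M N x) := by
  induction x with
  | zero => simp
  | add x y hx hy => rw [map_add, map_add, map_add, hx, hy]
  | tmul b m => rw [jet_tmul, _root_.map_smul, h, LinearMap.liftBaseChange_tmul]

end JetHom

/-! ### Differential operators tested on each open set. -/

section DiffOps

variable {k : Type u} [CommRing k] {X : Scheme.{u}} [X.Over (Spec (CommRingCat.of k))]
  {F₁ F₂ : X.Modules} {N : ℕ}

attribute [local instance] sectionsAlgebra sectionsModule sectionsScalarTower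

/-- A morphism of abelian sheaves is a differential operator of order `≤ N` if and only if its
value on every open set factors linearly through the `N`-th jets. -/
lemma mem_diffOps_iff (D : F₁.presheaf ⟶ F₂.presheaf) :
    D ∈ diffOps k F₁ F₂ N ↔ ∀ U : X.Opens,
      ∃ φ : Jet k Γ(X, U) Γ(F₁, U) N →ₗ[Γ(X, U)] Γ(F₂, U),
        ∀ m, φ (Jet.d k Γ(X, U) Γ(F₁, U) N m) = D.app (op U) m := by
  constructor
  · rintro ⟨E, rfl⟩ U
    let η := (PresheafOfModules.sheafificationAdjunction (𝟙 X.ringCatSheaf.obj)).unit.app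
      (jetPresheaf k F₁ N)
    let ψ := E.val.app (op U)
    exact ⟨{ toFun := fun x => E.app U (show Γ(jetSheaf k F₁ N, U) from η.app (op U) x)
             map_add' := fun x y => by
               refine (congrArg (E.app U) ((η.app (op U)).hom.map_add x y)).trans ?_
               exact map_add (E.app U).hom _ _
             map_smul' := fun b x => by
               refine (congrArg (E.app U) ((η.app (op U)).hom.map_smul b x)).trans ?_
               exact Scheme.Modules.Hom.app_smul E b _ }, fun m => rfl⟩
  · intro h
    choose φ hφ using h
    -- The maps `φ U` were chosen independently. They are compatible all the same: the image of `d`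
    -- generates the jets over the functions, and there they are given by `D`.
    let Φ : (jetPresheaf k F₁ N).presheaf ⟶ F₂.val.presheaf :=
      { app := fun U => AddCommGrpCat.ofHom (φ U.unop).toAddMonoidHom
        naturality := fun U V i => by
          refine AddCommGrpCat.hom_ext (Jet.addHom_ext fun b m => ?_)
          change φ V.unop (Jet.map N (resAlg k i.unop) (resLin k F₁ i.unop)
            (resLin_smul F₁ i.unop) (b • Jet.d k _ _ N m)) =
            F₂.presheaf.map i (φ U.unop (b • Jet.d k _ _ N m))
          rw [Jet.map_smul, Jet.map_d, _root_.map_smul, _root_.map_smul, hφ, hφ]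
          refine Eq.trans ?_ (F₂.map_smul i.unop b _).symm
          exact congrArg (fun y : Γ(F₂, V.unop) => resAlg k i.unop b • y)
            (CategoryTheory.congr_fun (D.naturality i) m) }
    let Φ' : jetPresheaf k F₁ N ⟶ (PresheafOfModules.restrictScalars (𝟙 X.ringCatSheaf.obj)).obj
        ((SheafOfModules.forget _).obj F₂) :=
      PresheafOfModules.homMk Φ fun U r m => (φ U.unop).map_smul r m
    refine ⟨(PresheafOfModules.sheafificationHomEquiv (𝟙 X.ringCatSheaf.obj)).symm Φ', ?_⟩
    have h1 := PresheafOfModules.toPresheaf_map_sheafificationHomEquiv_def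
      (𝟙 X.ringCatSheaf.obj)
      ((PresheafOfModules.sheafificationHomEquiv (𝟙 X.ringCatSheaf.obj)).symm Φ')
    rw [Equiv.apply_symm_apply] at h1
    have h2 : jetPreD k F₁ N ≫ Φ = D := by
      ext U m
      exact hφ U m
    refine Eq.trans ?_ h2
    refine (Category.assoc _ _ _).trans ?_
    exact congrArg (fun f => jetPreD k F₁ N ≫ f) h1.symm

lemma diffOps_mono {K : ℕ} (h : K ≤ N) : diffOps k F₁ F₂ K ⊆ diffOps k F₁ F₂ N := by
  intro D hD
  rw [mem_diffOps_iff] at hD ⊢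
  intro U
  obtain ⟨φ, hφ⟩ := hD U
  exact ⟨φ.comp (Jet.proj h), fun m => by rw [LinearMap.comp_apply, Jet.proj_d, hφ]⟩

end DiffOps

/-! ### The action of the diagonal ideal on the operator. -/

section Symbol

variable {k : Type u} [Field k] {n : ℕ} {B : Type v} [CommRing B] [Algebra k B]

lemma algebraMap_fracField (c : k) :
    algebraMap k (FracField k n) c = toFrac (MvPolynomial.C c) :=
  IsScalarTower.algebraMap_apply k (MvPolynomial (Fin (n + 1)) k) (FracField k n) c

/-- Constant power series. -/
def constAlg : FracField k n →ₐ[k] PowerSeries (FracField k n) :=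
  { PowerSeries.C with
    commutes' := fun c => (PowerSeries.algebraMap_apply (r := c)).symm }

/-- The shift, as a homomorphism of algebras. -/
def shiftAlg (q p : Fin (n + 1)) : FracField k n →ₐ[k] PowerSeries (FracField k n) :=
  { shift q p with
    commutes' := fun c => by
      rw [PowerSeries.algebraMap_apply, algebraMap_fracField, ← shift_C q p]
      rfl }

/-- The homomorphism `b ⊗ b' ↦ b · Φ(b')`, where `Φ` is the shift. -/
def shiftTensor (q p : Fin (n + 1)) (ε : B →ₐ[k] FracField k n) :
    B ⊗[k] B →ₐ[k] PowerSeries (FracField k n) :=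
  Algebra.TensorProduct.lift (constAlg.comp ε) ((shiftAlg q p).comp ε) fun _ _ => Commute.all _ _

lemma shiftTensor_tmul (q p : Fin (n + 1)) (ε : B →ₐ[k] FracField k n) (b b' : B) :
    shiftTensor q p ε (b ⊗ₜ b') = PowerSeries.C (ε b) * shift q p (ε b') :=
  Algebra.TensorProduct.lift_tmul _ _ _ _ _

/-- Modulo `τ` the homomorphism is multiplication followed by `ε`, so it sends `I` into `(τ)`, hence
`I ^ N` into `(τ ^ N)`. -/
lemma X_pow_dvd_shiftTensor (q p : Fin (n + 1)) (ε : B →ₐ[k] FracField k n) {N : ℕ}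
    {t : B ⊗[k] B} (ht : t ∈ KaehlerDifferential.ideal k B ^ N) :
    PowerSeries.X ^ N ∣ shiftTensor q p ε t := by
  have h1 : ∀ t : B ⊗[k] B, PowerSeries.constantCoeff (shiftTensor q p ε t) =
      ε (Algebra.TensorProduct.lmul' k t) := by
    intro t
    induction t with
    | zero => simp
    | add x y hx hy => rw [map_add, map_add, map_add, map_add, hx, hy]
    | tmul b b' => simp [shiftTensor_tmul, constantCoeff_shift]
  have h2 : (KaehlerDifferential.ideal k B).map (shiftTensor q p ε) ≤
      Ideal.span {PowerSeries.X} := by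
    rw [Ideal.map_le_iff_le_comap]
    intro s hs
    rw [Ideal.mem_comap, Ideal.mem_span_singleton, PowerSeries.X_dvd_iff, h1]
    have hs' : Algebra.TensorProduct.lmul' k (S := B) s = 0 := hs
    rw [hs', map_zero]
  have h3 := Ideal.mem_map_of_mem (shiftTensor q p ε) ht
  rw [Ideal.map_pow] at h3
  have h4 := Ideal.pow_right_mono h2 N h3
  rwa [Ideal.span_singleton_pow, Ideal.mem_span_singleton] at h4

variable {M : Type w} [AddCommGroup M] [Module k M] [Module B M] [IsScalarTower k B M]
  {M' : Type*} [AddCommGroup M'] [Module k M'] [Module B M'] [IsScalarTower k B M']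

/-- For `t = b ⊗ b'` this is multiplicativity of the shift, which pulls `b'` out of the derivative.
It turns the question of the order into one about divisibility by powers of `τ`. -/
lemma coord_liftBaseChange (q p : Fin (n + 1)) (ε : B →ₐ[k] FracField k n)
    (γ : FracField k n) (N : ℕ) (D : M →ₗ[k] M') (π : M →+ FracField k n)
    (hπ : ∀ (b : B) m, π (b • m) = ε b * π m) (ρ : M' →+ FracField k n)
    (hρ : ∀ (b : B) m, ρ (b • m) = ε b * ρ m) (hD : ∀ m, ρ (D m) = conjOp q p γ N (π m))
    (t : B ⊗[k] B) (m : M) :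
    ρ (D.liftBaseChange B (biAct k B M t (1 ⊗ₜ m))) =
      γ * PowerSeries.coeff N (shiftTensor q p ε t * shift q p (γ * π m)) := by
  induction t with
  | zero => simp
  | add x y hx hy =>
    rw [map_add, LinearMap.add_apply, map_add, map_add, hx, hy, map_add, add_mul, map_add, mul_add]
  | tmul b b' =>
    rw [biAct_tmul, mul_one, LinearMap.liftBaseChange_tmul, hρ, hD, conjOp_apply,
      shiftTensor_tmul, mul_assoc, PowerSeries.coeff_C_mul, ← map_mul, hπ]
    ring_nf

end Symbol

/-! ### The operator and its exact order. -/

section Main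

variable {k : Type u} [Field k] {n : ℕ}

attribute [local instance] sectionsAlgebra sectionsModule sectionsScalarTower

/-- The value at the generic point, as a homomorphism of algebras. -/
def evAlg {U : (ProjectiveSpace k n).Opens} (hU : genPoint k n ∈ U) :
    Γ(ProjectiveSpace k n, U) →ₐ[k] FracField k n where
  toRingHom := ev hU
  commutes' c := by
    rw [algebraMap_fracField]
    exact ev_algebraMap hU c

variable {F₁ F₂ : (ProjectiveSpace k n).Modules}
  {V₁ V₂ : (ProjectiveSpace k n).Opens} {r₁ r₂ : ℕ} {e₁ : Fin r₁ → Γ(F₁, V₁)}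
  {e₂ : Fin r₂ → Γ(F₂, V₂)}

lemma conjOp_const_mul (q p : Fin (n + 1)) (γ : FracField k n) (N : ℕ) (a : k)
    (u : FracField k n) : conjOp q p γ N (toFrac (MvPolynomial.C a) * u) =
      toFrac (MvPolynomial.C a) * conjOp q p γ N u := by
  rw [conjOp_apply, conjOp_apply, mul_left_comm, map_mul, shift_C, PowerSeries.coeff_C_mul,
    mul_left_comm]

/-- Existence of a morphism of sheaves with a prescribed effect on generic coordinates. -/
lemma exists_hom_of_genCoords (he₁ : IsBasisOn F₁ e₁) (he₂ : IsBasisOn F₂ e₂)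
    (h₁ : genPoint k n ∈ V₁) (h₂ : genPoint k n ∈ V₂) (hF₂ : HasLocalBases F₂)
    (Δ : (Fin r₁ → FracField k n) →+ (Fin r₂ → FracField k n))
    (hΔ : ∀ (U : (ProjectiveSpace k n).Opens) (s : Γ(F₁, U)), ∃ t : Γ(F₂, U),
      ∀ hU : genPoint k n ∈ U, he₂.genCoords h₂ hU t = Δ (he₁.genCoords h₁ hU s)) :
    ∃ D : F₁.presheaf ⟶ F₂.presheaf, ∀ (U : (ProjectiveSpace k n).Opens)
      (hU : genPoint k n ∈ U) (s : Γ(F₁, U)),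
      he₂.genCoords h₂ hU (D.app (op U) s) = Δ (he₁.genCoords h₁ hU s) := by
  choose t ht using hΔ
  let D : ∀ U : (ProjectiveSpace k n).Opens, Γ(F₁, U) →+ Γ(F₂, U) := fun U =>
    AddMonoidHom.mk' (t U) fun s s' => by
      refine he₂.genCoords_injective h₂ hF₂ fun hU => ?_
      rw [map_add, ht, ht, ht, map_add, map_add]
  refine ⟨{ app := fun U => AddCommGrpCat.ofHom (D U.unop)
            naturality := fun U V i => ?_ }, fun U hU s => ht U s hU⟩
  ext s
  change t V.unop (resSec F₁ (leOfHom i.unop) s) = resSec F₂ (leOfHom i.unop) (t U.unop s)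
  refine he₂.genCoords_injective h₂ hF₂ fun hV => ?_
  rw [ht, he₁.genCoords_res, he₂.genCoords_res, ht]

lemma exists_hasOrder (hn : 1 ≤ n) (he₁ : IsBasisOn F₁ e₁) (he₂ : IsBasisOn F₂ e₂)
    (h₁ : genPoint k n ∈ V₁) (h₂ : genPoint k n ∈ V₂) (hF₁ : HasLocalBases F₁)
    (hF₂ : HasLocalBases F₂) (m₁ : Fin r₁) (m₂ : Fin r₂) :
    ∃ N₀, ∀ N, N₀ ≤ N → ∃ D : F₁.presheaf ⟶ F₂.presheaf, HasOrder k D N := by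
  have hpq : (0 : Fin (n + 1)) ≠ Fin.last n := by
    rw [Ne, Fin.ext_iff]
    simp only [Fin.val_zero, Fin.val_last]
    omega
  obtain ⟨γ, N₀, hγ, hex⟩ := exists_uniform_section he₁ he₂ h₁ h₂ hF₁ hF₂ m₁ m₂ hpq
  refine ⟨N₀, fun N hN => ?_⟩
  obtain ⟨D, hD⟩ := exists_hom_of_genCoords he₁ he₂ h₁ h₂ hF₂
    (((AddMonoidHom.single (fun _ : Fin r₂ => FracField k n) m₂).comp
      (conjOp (Fin.last n) 0 γ N)).comp (Pi.evalAddMonoidHom (fun _ => FracField k n) m₁))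
    (hex N hN)
  replace hD : ∀ (U : (ProjectiveSpace k n).Opens) (hU : genPoint k n ∈ U) (s : Γ(F₁, U)),
      he₂.genCoords h₂ hU (D.app (op U) s) =
        Pi.single m₂ (conjOp (Fin.last n) 0 γ N (he₁.genCoords h₁ hU s m₁)) := hD
  let DU : ∀ U : (ProjectiveSpace k n).Opens, Γ(F₁, U) →ₗ[k] Γ(F₂, U) := fun U =>
    { (D.app (op U)).hom with
      map_smul' := fun a s => by
        refine he₂.genCoords_injective h₂ hF₂ fun hU => ?_
        have h3 : ev hU (algebraMap k Γ(ProjectiveSpace k n, U) a) = toFrac (MvPolynomial.C a) :=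
          ev_algebraMap hU a
        change he₂.genCoords h₂ hU (D.app (op U)
          (algebraMap k Γ(ProjectiveSpace k n, U) a • s)) = he₂.genCoords h₂ hU
            (algebraMap k Γ(ProjectiveSpace k n, U) a • D.app (op U) s)
        funext l
        rw [he₂.genCoords_smul, hD, hD, he₁.genCoords_smul, h3, conjOp_const_mul]
        by_cases hl : l = m₂
        · subst hl
          simp
        · simp [hl] }
  have key : ∀ (U : (ProjectiveSpace k n).Opens) (hU : genPoint k n ∈ U) (t) (s : Γ(F₁, U)),
      he₂.genCoords h₂ hU ((DU U).liftBaseChange Γ(ProjectiveSpace k n, U)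
        (biAct k _ _ t (1 ⊗ₜ s))) m₂ =
      γ * PowerSeries.coeff N (shiftTensor (Fin.last n) 0 (evAlg hU) t *
        shift (Fin.last n) 0 (γ * he₁.genCoords h₁ hU s m₁)) := by
    intro U hU t s
    refine coord_liftBaseChange (Fin.last n) 0 (evAlg hU) γ N (DU U)
      ((Pi.evalAddMonoidHom (fun _ => FracField k n) m₁).comp (he₁.genCoords h₁ hU))
      (fun b m => he₁.genCoords_smul h₁ hU b m m₁)
      ((Pi.evalAddMonoidHom (fun _ => FracField k n) m₂).comp (he₂.genCoords h₂ hU))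
      (fun b m => he₂.genCoords_smul h₂ hU b m m₂) (fun m => ?_) t s
    exact (congrFun (hD U hU m) m₂).trans (Pi.single_eq_same _ _)
  have key' : ∀ (U : (ProjectiveSpace k n).Opens) (hU : genPoint k n ∈ U) (x) (l : Fin r₂),
      l ≠ m₂ → he₂.genCoords h₂ hU ((DU U).liftBaseChange Γ(ProjectiveSpace k n, U) x) l = 0 := by
    intro U hU x l hl
    induction x with
    | zero => simp
    | add x y hx hy => rw [map_add, map_add, Pi.add_apply, hx, hy, add_zero]
    | tmul b s =>
      rw [LinearMap.liftBaseChange_tmul, he₂.genCoords_smul]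
      change _ * he₂.genCoords h₂ hU (D.app (op U) s) l = 0
      rw [hD, Pi.single_eq_of_ne hl, mul_zero]
  refine ⟨D, (mem_diffOps_iff D).2 fun U => ⟨Jet.lift (DU U) fun t ht s => ?_,
    fun s => Jet.lift_d _ _ s⟩, fun K hK hDK => ?_⟩
  · refine he₂.genCoords_injective h₂ hF₂ fun hU => ?_
    funext l
    rw [map_zero, Pi.zero_apply]
    by_cases hl : l = m₂
    · subst hl
      -- An element of `I ^ (N + 1)` gives a multiple of `τ ^ (N + 1)`, whose coefficient of index
      -- `N` vanishes.
      obtain ⟨v, hv⟩ := X_pow_dvd_shiftTensor (Fin.last n) 0 (evAlg hU) ht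
      rw [key, hv, mul_assoc, PowerSeries.coeff_X_pow_mul', if_neg (by omega), mul_zero]
    · exact key' U hU _ l hl
  -- Here `p = 0`, so `y = x_n / x_0` is a function on the chart 0. For `K < N`, the element `(1 ⊗ y
  -- - y ⊗ 1) ^ N` lies in `I ^ (K + 1)`: a factorization through `K`-jets would give 0 on the basis
  -- section `e₁ m₁`, whereas the formula `key` gives `γ * γ`.
  · let U : (ProjectiveSpace k n).Opens := V₁ ⊓ chart 0
    have hU : genPoint k n ∈ U := genPoint_mem_inf h₁ (genPoint_mem_chart 0)
    obtain ⟨φ, hφ⟩ := (mem_diffOps_iff D).1 hDK U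
    let y : Γ(ProjectiveSpace k n, U) := resFun inf_le_right (coord (Fin.last n) 0)
    have hy : ev hU y = toFrac (MvPolynomial.X (Fin.last n)) / toFrac (MvPolynomial.X 0) := by
      rw [ev_res, ev_coord]
    have ht : (1 ⊗ₜ y - y ⊗ₜ 1 : Γ(ProjectiveSpace k n, U) ⊗[k] Γ(ProjectiveSpace k n, U)) ∈
        KaehlerDifferential.ideal k Γ(ProjectiveSpace k n, U) :=
      KaehlerDifferential.one_smul_sub_smul_one_mem_ideal k y
    have h3 : φ (Jet.mk k _ _ K (biAct k _ _ ((1 ⊗ₜ y - y ⊗ₜ 1) ^ N)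
        (1 ⊗ₜ resSec F₁ inf_le_left (e₁ m₁)))) = 0 := by
      have : Jet.mk k _ _ K (biAct k _ Γ(F₁, U) ((1 ⊗ₜ y - y ⊗ₜ 1) ^ N)
          (1 ⊗ₜ resSec F₁ inf_le_left (e₁ m₁))) = 0 :=
        (Submodule.Quotient.mk_eq_zero _).2 (Submodule.subset_span
          ⟨_, Ideal.pow_le_pow_right (by omega) (Ideal.pow_mem_pow ht N), _, rfl⟩)
      rw [this, map_zero]
    have h4 := key U hU ((1 ⊗ₜ y - y ⊗ₜ 1) ^ N) (resSec F₁ inf_le_left (e₁ m₁))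
    rw [liftBaseChange_eq (DU U) φ hφ, h3, map_zero, Pi.zero_apply, map_pow, map_sub,
      shiftTensor_tmul, shiftTensor_tmul, map_one, map_one, map_one, one_mul, mul_one] at h4
    change 0 = γ * PowerSeries.coeff N ((shift (Fin.last n) 0 (ev hU y) -
      PowerSeries.C (ev hU y)) ^ N * _) at h4
    rw [hy, shift_div hpq, add_sub_cancel_left, PowerSeries.coeff_X_pow_mul', if_pos le_rfl,
      Nat.sub_self, PowerSeries.coeff_zero_eq_constantCoeff_apply, constantCoeff_shift,
      he₁.genCoords_eq_coords h₁ hU inf_le_left, he₁.coords_basis, Pi.single_eq_same, map_one,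
      mul_one] at h4
    exact mul_ne_zero hγ hγ h4.symm

end Main

/-! ### Local bases of glued sheaves. -/

section Gluing

variable {X : Scheme.{u}} {ι : Type} {D : ι → X.Opens} {g : ∀ i j, Γ(X, D i ⊓ D j)}

/-- The transition functions `g` satisfy the cocycle condition. -/
structure IsCocycle (g : ∀ i j, Γ(X, D i ⊓ D j)) : Prop where
  self : ∀ i, g i i = 1
  trans : ∀ i a b, resFun (le_inf inf_le_left (inf_le_right.trans inf_le_right) :
    D i ⊓ (D a ⊓ D b) ≤ D i ⊓ D b) (g i b) =
      resFun inf_le_right (g a b) * resFun (inf_le_inf_left _ inf_le_left) (g i a)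

lemma IsCocycle.trans_res (hg : IsCocycle g) {i a b : ι} {V : X.Opens} (h₁ : V ≤ D i ⊓ D b)
    (h₂ : V ≤ D a ⊓ D b) (h₃ : V ≤ D i ⊓ D a) :
    resFun h₁ (g i b) = resFun h₂ (g a b) * resFun h₃ (g i a) := by
  have h : V ≤ D i ⊓ (D a ⊓ D b) := le_inf (h₁.trans inf_le_left) h₂
  have := congrArg (resFun h) (hg.trans i a b)
  rwa [map_mul, resFun_resFun, resFun_resFun, resFun_resFun] at this

variable (E : X.Modules)

/-- The section of the glued sheaf determined by its value on an open subset of `D i`. -/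
def gluedOf (hg : IsCocycle g) (i : ι) {U : X.Opens} (hU : U ≤ D i) (s : Γ(E, U)) :
    Γ(glued D g E, U) :=
  show gluedSections D g E U from
  ⟨fun l => resFun (inf_le_inf_right (D l) hU) (g i l) • resSec E inf_le_left s, fun a b => by
    rw [resSec_smul, resSec_smul, resFun_resFun, resFun_resFun, resSec_resSec, resSec_resSec,
      smul_smul, ← hg.trans_res]⟩

/-- Over `U ≤ D i` the member of index `i` determines the family by `s l = g i l • s i`, and `g i i
= 1` recovers it. -/
lemma gluedOf_bijective (hg : IsCocycle g) (i : ι) {U : X.Opens} (hU : U ≤ D i) :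
    Function.Bijective (gluedOf E hg i hU) := by
  constructor
  · intro s t hst
    have h1 := congrFun (congrArg Subtype.val
      (show (gluedOf E hg i hU s : gluedSections D g E U) = gluedOf E hg i hU t from hst)) i
    change resFun _ (g i i) • resSec E _ s = resFun _ (g i i) • resSec E _ t at h1
    rw [hg.self, map_one, one_smul, one_smul] at h1
    have h2 := congrArg (resSec E (le_inf le_rfl hU : U ≤ U ⊓ D i)) h1
    rwa [resSec_resSec, resSec_resSec, resSec_self, resSec_self] at h2
  · intro t
    let t' : gluedSections D g E U := t
    refine ⟨resSec E (le_inf le_rfl hU) (t'.1 i), ?_⟩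
    refine Subtype.ext (funext fun l => ?_)
    have h1 := congrArg (resSec E (le_inf inf_le_left (inf_le_inf_right (D l) hU) :
      U ⊓ D l ≤ U ⊓ (D i ⊓ D l))) (t'.2 i l)
    rw [resSec_smul, resSec_resSec, resSec_resSec, resSec_self, resFun_resFun] at h1
    refine Eq.trans ?_ h1.symm
    have h2 : U ⊓ D l ≤ D i ⊓ D l := inf_le_inf_right (D l) hU
    have h3 : U ⊓ D l ≤ U := inf_le_left
    have h4 : U ≤ U ⊓ D i := le_inf le_rfl hU
    change resFun h2 (g i l) • resSec E h3 (resSec E h4 (t'.1 i)) = _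
    rw [resSec_resSec]

lemma gluedOf_sum (hg : IsCocycle g) (i : ι) {W U : X.Opens} (hW : W ≤ D i) (hU : U ≤ W) {r : ℕ}
    (e : Fin r → Γ(E, W)) (c : Fin r → Γ(X, U)) :
    ∑ l, c l • resSec (glued D g E) hU (gluedOf E hg i hW (e l)) =
      gluedOf E hg i (hU.trans hW) (∑ l, c l • resSec E hU (e l)) := by
  let τ : Γ(E, U) →+ Γ(glued D g E, U) := AddMonoidHom.mk' (gluedOf E hg i (hU.trans hW))
    fun s t => Subtype.ext (funext fun l => by
      have h₁ : U ⊓ D l ≤ D i ⊓ D l := inf_le_inf_right (D l) (hU.trans hW)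
      have h₂ : U ⊓ D l ≤ U := inf_le_left
      change resFun h₁ (g i l) • resSec E h₂ (s + t) =
        resFun h₁ (g i l) • resSec E h₂ s + resFun h₁ (g i l) • resSec E h₂ t
      rw [map_add, smul_add])
  change _ = τ _
  rw [map_sum]
  refine Finset.sum_congr rfl fun m _ => Subtype.ext (funext fun l => ?_)
  have h₁ : U ⊓ D l ≤ D i ⊓ D l := inf_le_inf_right (D l) (hU.trans hW)
  have h₂ : U ⊓ D l ≤ U := inf_le_left
  have h₃ : U ⊓ D l ≤ W ⊓ D l := inf_le_inf_right (D l) hU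
  have h₄ : W ⊓ D l ≤ D i ⊓ D l := inf_le_inf_right (D l) hW
  have h₅ : W ⊓ D l ≤ W := inf_le_left
  change resFun h₂ (c m) • resSec E h₃ (resFun h₄ (g i l) • resSec E h₅ (e m)) =
    resFun h₁ (g i l) • resSec E h₂ (c m • resSec E hU (e m))
  rw [resSec_smul, resSec_smul, resFun_resFun, resSec_resSec, resSec_resSec, smul_smul, smul_smul,
    mul_comm]

lemma IsBasisOn.glued {E : X.Modules} (hg : IsCocycle g) (i : ι) {W : X.Opens} (hW : W ≤ D i)
    {r : ℕ} {e : Fin r → Γ(E, W)} (he : IsBasisOn E e) :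
    IsBasisOn (GlobalDiffOp.glued D g E) fun l => gluedOf E hg i hW (e l) := by
  intro U hU
  have := (gluedOf_bijective E hg i (hU.trans hW)).comp (he U hU)
  convert this using 1
  funext c
  exact gluedOf_sum E hg i hW hU e c

lemma IsBasisOn.res {E : X.Modules} {W W' : X.Opens} (h : W' ≤ W) {r : ℕ} {e : Fin r → Γ(E, W)}
    (he : IsBasisOn E e) : IsBasisOn E fun l => resSec E h (e l) := by
  intro U hU
  convert he U (hU.trans h) using 4
  rw [resSec_resSec]

end Gluing

/-! ### Serre twists and the theorem. -/

section Final

variable {k : Type u} [Field k] {n : ℕ}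

lemma ev_coordPow (d : ℤ) (i j : Fin (n + 1))
    (h : genPoint k n ∈ chart (k := k) i ⊓ chart j) :
    ev h (coordPow d i j) =
      (toFrac (MvPolynomial.X i) / toFrac (MvPolynomial.X j)) ^ d.toNat *
        (toFrac (MvPolynomial.X j) / toFrac (MvPolynomial.X i)) ^ (-d).toNat := by
  rw [coordPow, map_mul, map_pow, map_pow, ev_res, ev_res, ev_coord, ev_coord]

/-- The identities are checked at the generic point, where `ev` is injective; the two natural-number
powers are multiplicative separately, so the sign of `d` plays no role. -/
lemma isCocycle_coordPow (d : ℤ) :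
    IsCocycle (D := chart (k := k) (n := n)) fun i j => coordPow d i j where
  self i := by
    have hi : toFrac (k := k) (MvPolynomial.X i) ≠ 0 := toFrac_ne_zero (MvPolynomial.X_ne_zero i)
    have h := genPoint_mem_inf (genPoint_mem_chart (k := k) i) (genPoint_mem_chart i)
    refine ev_injective h ?_
    rw [ev_coordPow, map_one, div_self hi, one_pow, one_pow, one_mul]
  trans i a b := by
    have hi : toFrac (k := k) (MvPolynomial.X i) ≠ 0 := toFrac_ne_zero (MvPolynomial.X_ne_zero i)
    have ha : toFrac (k := k) (MvPolynomial.X a) ≠ 0 := toFrac_ne_zero (MvPolynomial.X_ne_zero a)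
    have hb : toFrac (k := k) (MvPolynomial.X b) ≠ 0 := toFrac_ne_zero (MvPolynomial.X_ne_zero b)
    have h := genPoint_mem_inf (genPoint_mem_chart (k := k) i)
      (genPoint_mem_inf (genPoint_mem_chart a) (genPoint_mem_chart b))
    refine ev_injective h ?_
    rw [map_mul, ev_res, ev_res, ev_res, ev_coordPow, ev_coordPow, ev_coordPow,
      mul_mul_mul_comm, ← mul_pow, ← mul_pow, div_mul_div_cancel₀' ha, div_mul_div_cancel₀ ha]

/-- The rank `r` is unchanged, which is how the twist of a nonzero sheaf is seen to have a nonempty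
basis. -/
lemma exists_basis_serreTwist {E : (ProjectiveSpace k n).Modules} (d : ℤ)
    {W : (ProjectiveSpace k n).Opens} {r : ℕ} {e : Fin r → Γ(E, W)} (he : IsBasisOn E e)
    {x : ProjectiveSpace k n} (hx : x ∈ W) :
    ∃ (W' : (ProjectiveSpace k n).Opens) (_ : x ∈ W') (e' : Fin r → Γ(serreTwist E d, W')),
      IsBasisOn (serreTwist E d) e' := by
  obtain ⟨i, hi⟩ := exists_mem_chart x
  exact ⟨W ⊓ chart i, ⟨hx, hi⟩, _, (he.res inf_le_left).glued (isCocycle_coordPow d) i inf_le_right⟩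

lemma HasLocalBases.serreTwist {E : (ProjectiveSpace k n).Modules} (hE : HasLocalBases E) (d : ℤ) :
    HasLocalBases (GlobalDiffOp.serreTwist E d) := by
  intro x
  obtain ⟨W, hx, r, e, he⟩ := hE x
  obtain ⟨W', hx', e', he'⟩ := exists_basis_serreTwist d he hx
  exact ⟨W', hx', r, e', he'⟩

end Final

end GlobalDiffOp

end

theorem mainTheorem1 (k : Type u) [Field k] (n : ℕ) (hn : 2 ≤ n) :
    (∀ F₁ F₂ : (GlobalDiffOp.ProjectiveSpace k n).Modules,
      GlobalDiffOp.IsLocallyFreeOfFiniteRank F₁ → GlobalDiffOp.IsLocallyFreeOfFiniteRank F₂ →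
      ¬ CategoryTheory.Limits.IsZero F₁ → ¬ CategoryTheory.Limits.IsZero F₂ →
      ∃ N₀ : ℕ, 1 ≤ N₀ ∧ ∀ N : ℕ, N₀ ≤ N →
        GlobalDiffOp.diffOps k F₁ F₂ (N - 1) ⊂ GlobalDiffOp.diffOps k F₁ F₂ N ∧
        ∃ D : F₁.presheaf ⟶ F₂.presheaf, GlobalDiffOp.HasOrder k D N) ∧
    (∀ E : (GlobalDiffOp.ProjectiveSpace k n).Modules,
      GlobalDiffOp.IsLocallyFreeOfFiniteRank E → ¬ CategoryTheory.Limits.IsZero E →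
      ∀ d : ℤ, ∃ N₀ : ℕ, 1 ≤ N₀ ∧ ∀ N : ℕ, N₀ ≤ N →
        ∃ D : E.presheaf ⟶ (GlobalDiffOp.serreTwist E d).presheaf,
          GlobalDiffOp.HasOrder k D N) := by
  refine ⟨fun F₁ F₂ hF₁ hF₂ h₁ h₂ => ?_, fun E hE h d => ?_⟩
  · obtain ⟨x₁, W₁, hx₁, r₁, e₁, he₁, hr₁⟩ :=
      GlobalDiffOp.exists_basis_of_not_isZero hF₁.hasLocalBases h₁
    obtain ⟨x₂, W₂, hx₂, r₂, e₂, he₂, hr₂⟩ :=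
      GlobalDiffOp.exists_basis_of_not_isZero hF₂.hasLocalBases h₂
    obtain ⟨N₀, hN₀⟩ := GlobalDiffOp.exists_hasOrder (by omega) he₁ he₂
      (GlobalDiffOp.genPoint_mem hx₁) (GlobalDiffOp.genPoint_mem hx₂) hF₁.hasLocalBases
      hF₂.hasLocalBases ⟨0, hr₁⟩ ⟨0, hr₂⟩
    -- The bound 1 makes `N - 1 < N` hold for truncated subtraction; the operator of order `N` then
    -- witnesses strictness.
    refine ⟨max 1 N₀, le_max_left _ _, fun N hN => ?_⟩
    obtain ⟨D, hD⟩ := hN₀ N ((le_max_right _ _).trans hN)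
    have h1 : 1 ≤ N := (le_max_left _ _).trans hN
    refine ⟨(Set.ssubset_iff_of_subset (GlobalDiffOp.diffOps_mono (Nat.sub_le N 1))).2
      ⟨D, hD.1, hD.2 (N - 1) (by omega)⟩, D, hD⟩
  · obtain ⟨x, W, hx, r, e, he, hr⟩ := GlobalDiffOp.exists_basis_of_not_isZero hE.hasLocalBases h
    obtain ⟨W', hx', e', he'⟩ := GlobalDiffOp.exists_basis_serreTwist d he hx
    obtain ⟨N₀, hN₀⟩ := GlobalDiffOp.exists_hasOrder (by omega) he he'
      (GlobalDiffOp.genPoint_mem hx) (GlobalDiffOp.genPoint_mem hx') hE.hasLocalBases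
      (hE.hasLocalBases.serreTwist d) ⟨0, hr⟩ ⟨0, hr⟩
    exact ⟨max 1 N₀, le_max_left _ _, fun N hN => hN₀ N ((le_max_right _ _).trans hN)⟩
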